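/- Let $N\in\mathbb N$ and consider the system $x_{t+1}=Ax_t+Bu_t+w_{t+1}$, $y_t=Cx_t+v_t$ with $x_t\in\mathbb R^n$, $u_t\in\mathbb R^p$, $y_t\in\mathbb R^m$ and deterministic $x_0$, where the pairs $(w_t,v_t)$, $t\ge 0$, are i.i.d. (with an arbitrary joint law) and $\mathbb E\|w_t\|_2^q<\infty$ for every $q\ge 1$. Let $\bar w=\mathbb E w_t$, let $Q\succeq 0$ and $R\succ 0$ be symmetric, and let $\epsilon\in\mathbb R$ and $\mu\ge 0$. An input process $u$ is admissible if, for every $t\le N-1$, $u_t$ is measurable with respect to $\sigma(z_t)$, where $z_t=(y_{0:t},u_{0:t-1})$, and $u_t\in L^4$. For an input process let $\mathcal F_t=\sigma(y_{0:t},u_{0:t})$, with $\mathcal F_{-1}$ trivial, $\hat x_{t|t}=\mathbb E(x_t|\mathcal F_t)$, $\hat x_t=\mathbb E(x_t|\mathcal F_{t-1})$, $\delta_t=x_t-\hat x_t$, $e_t=\hat x_{t|t}-\hat x_t$, and $$W_t=\mathbb E(\delta_{t+1}\delta_{t+1}'|\mathcal F_t),\quad m_{3,t}=2Q\,\mathbb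 E(\delta_{t+1}\delta_{t+1}'Q\delta_{t+1}|\mathcal F_t),\quad m_{4,t}=\mathbb E\big((\delta_{t+1}'Q\delta_{t+1}-\mathrm{Tr}(QW_t))^2|\mathcal F_t\big),$$ $Q_{\mu,t}=Q+4\mu QW_tQ$. The Lagrangian is $\mathcal L(u,\mu)=J(u)+\mu J_R(u)-\mu\bar\epsilon$ with $$J(u)=\mathbb E\Big\{x_N'Qx_N+\sum_{t=0}^{N-1}(x_t'Qx_t+u_t'Ru_t)\Big\},\quad J_R(u)=\mathbb E\sum_{t=1}^{N}\big(4\hat x_t'QW_{t-1}Q\hat x_t+2\hat x_t'm_{3,t-1}\big),\quad \bar\epsilon=\epsilon-\sum_{t=1}^N\mathbb E\,m_{4,t-1},$$ and the dual function is $D(\mu)=\inf_u\mathcal L(u,\mu)$ over admissible $u$. With $g_t=\hat x_{t+1}'Q_{\mu,t}\hat x_{t+1}+2\mu\hat x_{t+1}'m_{3,t}+u_t'Ru_t$, the optimal cost-to-go $\mathcal L^*_k(z_k,\mu)$ after admissible inputs $u_{0:k-1}$ is the essential infimum of $\mathbb E\{\sum_{t=k}^{N-1}g_t|\mathcal F_k\}$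 over all admissible continuations $u_{k:N-1}$. Define random coefficients along an admissible input by $P_N=0$, $\zeta_N=0$, $c_N=0$ and, for $t=N-1,\dots,0$, $$\begin{aligned} V_t&=\mathbb E(P_{t+1}|\mathcal F_t)+Q_{\mu,t},\qquad \xi_t=\mathbb E(P_{t+1}e_{t+1}+\zeta_{t+1}|\mathcal F_t)+\mu m_{3,t},\\ d_t&=\mathbb E(c_{t+1}+e_{t+1}'P_{t+1}e_{t+1}+2e_{t+1}'\zeta_{t+1}|\mathcal F_t),\\ K_t&=-(B'V_tB+R)^{-1}B'V_tA,\qquad l_t=-(B'V_tB+R)^{-1}B'(\xi_t+V_t\bar w),\\ P_t&=(A+BK_t)'V_t(A+BK_t)+K_t'RK_t,\qquad \zeta_t=(A+BK_t)'(\xi_t+V_t\bar w),\\ c_t&=d_t+\bar w'V_t\bar w-l_t'(B'V_tB+R)l_t+2\xi_t'\bar w. \end{aligned}$$ Then: (i) Along every admissible input, the random variables whose expectations or conditional expectations enter the definitions of the coefficients, of $\mathcal L$ and of the cost-to-go are integrable, $B'V_tB+R$ is a.s. invertible, $P_t,\zeta_t,c_t$ are $\mathcal F_t$-measurable, and for every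 $t\le N-1$ $$\mathcal L^*_t(z_t,\mu)=\hat x_{t|t}'P_t\hat x_{t|t}+2\zeta_t'\hat x_{t|t}+c_t\quad\text{a.s.}$$ (ii) There is an admissible input $u^*$ (in particular $u^*_t\in L^4$) with $u^*_t=K_t\hat x_{t|t}+l_t$ a.s. for all $t\le N-1$, and every admissible input that satisfies this feedback law a.s. attains the dual value: $\mathcal L(u^*,\mu)=D(\mu)$. -/

import Mathlib

open MeasureTheory ProbabilityTheory
open scoped Matrix

noncomputable section

/-- The data of a partially observed linear system `x_{t+1} = A x_t + B u_t + w_{t+1}`,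
`y_t = C x_t + v_t` with deterministic initial state `x₀`, horizon `N`, and the penalty
matrices `Q`, `R` of the quadratic cost.  The noises `w`, `v` are processes on `Ω`. -/
structure LQSystem (Ω : Type*) (n p m : ℕ) where
  A : Matrix (Fin n) (Fin n) ℝ
  B : Matrix (Fin n) (Fin p) ℝ
  C : Matrix (Fin m) (Fin n) ℝ
  Q : Matrix (Fin n) (Fin n) ℝ
  R : Matrix (Fin p) (Fin p) ℝ
  x₀ : Fin n → ℝ
  N : ℕ
  w : ℕ → Ω → (Fin n → ℝ)
  v : ℕ → Ω → (Fin m → ℝ)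

/-- Entrywise conditional expectation of a random vector. -/
def condVec {Ω : Type*} [MeasurableSpace Ω] (Pr : Measure Ω) (𝓖 : MeasurableSpace Ω) {k : ℕ}
    (Z : Ω → (Fin k → ℝ)) : Ω → (Fin k → ℝ) :=
  fun ω i => condExp 𝓖 Pr (fun ω' => Z ω' i) ω

/-- Entrywise conditional expectation of a random matrix. -/
def condMat {Ω : Type*} [MeasurableSpace Ω] (Pr : Measure Ω) (𝓖 : MeasurableSpace Ω) {k l : ℕ}
    (Z : Ω → Matrix (Fin k) (Fin l) ℝ) : Ω → Matrix (Fin k) (Fin l) ℝ :=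
  fun ω => Matrix.of fun i j => condExp 𝓖 Pr (fun ω' => Z ω' i j) ω

/-- `h` is the essential infimum of the family `S` of real random variables: `h` is measurable,
it is an almost sure lower bound of every member, and it dominates almost surely every other
measurable almost sure lower bound. -/
def IsEssInf {Ω : Type*} [MeasurableSpace Ω] (Pr : Measure Ω) (S : Set (Ω → ℝ)) (h : Ω → ℝ) :
    Prop :=
  Measurable h ∧ (∀ f ∈ S, h ≤ᵐ[Pr] f) ∧
    ∀ g : Ω → ℝ, Measurable g → (∀ f ∈ S, g ≤ᵐ[Pr] f) → g ≤ᵐ[Pr] h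

/-- The random coefficients `P, ζ, c` of a quadratic function `x ↦ x' P x + 2 ζ' x + c`. -/
structure QuadCoeff (Ω : Type*) (n : ℕ) where
  P : Ω → Matrix (Fin n) (Fin n) ℝ
  ζ : Ω → (Fin n → ℝ)
  c : Ω → ℝ

namespace LQSystem

section Dynamics

variable {Ω : Type*} {n p m : ℕ} (S : LQSystem Ω n p m) (u : ℕ → Ω → (Fin p → ℝ))

/-- The state process under the input process `u`. -/
def x : ℕ → Ω → (Fin n → ℝ)
  | 0 => fun _ => S.x₀
  | t + 1 => fun ω => S.A *ᵥ x t ω + S.B *ᵥ u t ω + S.w (t + 1) ω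

/-- The output process under the input process `u`. -/
def y (t : ℕ) : Ω → (Fin m → ℝ) :=
  fun ω => S.C *ᵥ S.x u t ω + S.v t ω

/-- The σ-algebra generated by `z_t = (y_0, …, y_t, u_0, …, u_{t-1})`, which is the information
that is available when the input `u_t` is chosen. -/
def info (t : ℕ) : MeasurableSpace Ω :=
  (⨆ s : ℕ, ⨆ _ : s ≤ t, MeasurableSpace.comap (S.y u s) inferInstance) ⊔
    (⨆ s : ℕ, ⨆ _ : s < t, MeasurableSpace.comap (u s) inferInstance)

/-- The σ-algebra `F_t` generated by `y_0, …, y_t, u_0, …, u_t`. -/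
def F (t : ℕ) : MeasurableSpace Ω :=
  (⨆ s : ℕ, ⨆ _ : s ≤ t, MeasurableSpace.comap (S.y u s) inferInstance) ⊔
    (⨆ s : ℕ, ⨆ _ : s ≤ t, MeasurableSpace.comap (u s) inferInstance)

end Dynamics

section Control

variable {Ω : Type*} [MeasurableSpace Ω] {n p m : ℕ} (S : LQSystem Ω n p m) (Pr : Measure Ω)

/-- Causal input processes with finite fourth moments: for `t < N` the input `u_t` is a
function of `z_t` and belongs to `L⁴`. -/
def Admissible (u : ℕ → Ω → (Fin p → ℝ)) : Prop :=
  ∀ t < S.N, Measurable[S.info u t] (u t) ∧ MemLp (fun ω => WithLp.toLp 2 (u t ω)) 4 Pr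

/-- The mean of the process noise. -/
def wbar : Fin n → ℝ := fun i => ∫ ω, S.w 0 ω i ∂Pr

variable (u : ℕ → Ω → (Fin p → ℝ))

/-- The estimate `E(x_t | F_t)`. -/
def xEst (t : ℕ) : Ω → (Fin n → ℝ) := condVec Pr (S.F u t) (S.x u t)

/-- The prediction `E(x_t | F_{t-1})`, where `F_{-1}` is trivial. -/
def xPred : ℕ → Ω → (Fin n → ℝ)
  | 0 => condVec Pr ⊥ (S.x u 0)
  | t + 1 => condVec Pr (S.F u t) (S.x u (t + 1))

/-- The innovation (prediction error) `δ_t = x_t - E(x_t | F_{t-1})`. -/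
def δ (t : ℕ) : Ω → (Fin n → ℝ) := fun ω => S.x u t ω - S.xPred Pr u t ω

/-- The refinement error `e_t = E(x_t | F_t) - E(x_t | F_{t-1})`. -/
def e (t : ℕ) : Ω → (Fin n → ℝ) := fun ω => S.xEst Pr u t ω - S.xPred Pr u t ω

/-- `W_t = E(δ_{t+1} δ_{t+1}' | F_t)`. -/
def W (t : ℕ) : Ω → Matrix (Fin n) (Fin n) ℝ :=
  condMat Pr (S.F u t) fun ω => Matrix.vecMulVec (S.δ Pr u (t + 1) ω) (S.δ Pr u (t + 1) ω)

/-- `m_{3,t} = 2 Q E(δ_{t+1} δ_{t+1}' Q δ_{t+1} | F_t)`. -/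
def m₃ (t : ℕ) : Ω → (Fin n → ℝ) := fun ω =>
  (2 : ℝ) • (S.Q *ᵥ condVec Pr (S.F u t) (fun ω' =>
    (S.δ Pr u (t + 1) ω' ⬝ᵥ S.Q *ᵥ S.δ Pr u (t + 1) ω') • S.δ Pr u (t + 1) ω') ω)

/-- The square whose conditional expectation is the fourth moment term `m_{4,t}`. -/
def m₄Arg (t : ℕ) : Ω → ℝ := fun ω =>
  (S.δ Pr u (t + 1) ω ⬝ᵥ S.Q *ᵥ S.δ Pr u (t + 1) ω - (S.Q * S.W Pr u t ω).trace) ^ 2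

/-- `m_{4,t} = E((δ_{t+1}' Q δ_{t+1} - Tr(Q W_t))² | F_t)`. -/
def m₄ (t : ℕ) : Ω → ℝ := condExp (S.F u t) Pr (S.m₄Arg Pr u t)

/-- The random LQ cost. -/
def lqCost : Ω → ℝ := fun ω =>
  S.x u S.N ω ⬝ᵥ S.Q *ᵥ S.x u S.N ω +
    ∑ t ∈ Finset.range S.N,
      (S.x u t ω ⬝ᵥ S.Q *ᵥ S.x u t ω + u t ω ⬝ᵥ S.R *ᵥ u t ω)

/-- The random quadratic risk, `∑_{t=1}^N 4 x̂_t' Q W_{t-1} Q x̂_t + 2 x̂_t' m_{3,t-1}`. -/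
def riskCost : Ω → ℝ := fun ω =>
  ∑ t ∈ Finset.range S.N,
    (4 * (S.xPred Pr u (t + 1) ω ⬝ᵥ (S.Q * S.W Pr u t ω * S.Q) *ᵥ S.xPred Pr u (t + 1) ω) +
      2 * (S.xPred Pr u (t + 1) ω ⬝ᵥ S.m₃ Pr u t ω))

/-- The LQ objective. -/
def J : ℝ := ∫ ω, S.lqCost u ω ∂Pr

/-- The quadratic risk functional. -/
def JR : ℝ := ∫ ω, S.riskCost Pr u ω ∂Pr

/-- The reduced risk level `ε - ∑_{t=1}^N E m_{4,t-1}`. -/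
def epsBar (ε : ℝ) : ℝ := ε - ∑ t ∈ Finset.range S.N, ∫ ω, S.m₄ Pr u t ω ∂Pr

/-- The Lagrangian. -/
def Lagrangian (ε μ : ℝ) : ℝ := S.J Pr u + μ * S.JR Pr u - μ * S.epsBar Pr u ε

/-- The dual function: the infimum of the Lagrangian over the admissible inputs. -/
def dual (ε μ : ℝ) : EReal :=
  ⨅ u : {u : ℕ → Ω → (Fin p → ℝ) // S.Admissible Pr u}, (S.Lagrangian Pr u.1 ε μ : EReal)

/-- The inflated state penalty `Q + 4 μ Q W_t Q`. -/
def Qμ (μ : ℝ) (t : ℕ) : Ω → Matrix (Fin n) (Fin n) ℝ := fun ω =>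
  S.Q + (4 * μ) • (S.Q * S.W Pr u t ω * S.Q)

/-- The stage cost
`g_t = x̂_{t+1}' (Q + 4 μ Q W_t Q) x̂_{t+1} + 2 μ x̂_{t+1}' m_{3,t} + u_t' R u_t`. -/
def g (μ : ℝ) (t : ℕ) : Ω → ℝ := fun ω =>
  S.xPred Pr u (t + 1) ω ⬝ᵥ S.Qμ Pr u μ t ω *ᵥ S.xPred Pr u (t + 1) ω +
    2 * μ * (S.xPred Pr u (t + 1) ω ⬝ᵥ S.m₃ Pr u t ω) + u t ω ⬝ᵥ S.R *ᵥ u t ω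

/-- The conditional cost from stage `k` on, given `F_k`, under the input `u`. -/
def costFrom (μ : ℝ) (k : ℕ) : Ω → ℝ :=
  condExp (S.F u k) Pr fun ω => ∑ t ∈ Finset.Ico k S.N, S.g Pr u μ t ω

/-- The admissible inputs that agree with `u` strictly before stage `k`. -/
def continuations (k : ℕ) : Set (ℕ → Ω → (Fin p → ℝ)) :=
  {u' | S.Admissible Pr u' ∧ ∀ s < k, u' s = u s}

/-- `L` is the optimal cost-to-go at stage `k` when the inputs before stage `k` are those of `u`:
the (essential) infimum of the conditional cost from stage `k` on, over the admissible
continuations `u_k, …, u_{N-1}`. -/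
def IsOptimalCostToGo (μ : ℝ) (k : ℕ) (L : Ω → ℝ) : Prop :=
  IsEssInf Pr {f | ∃ u' ∈ S.continuations Pr u k, f = S.costFrom Pr u' μ k} L

/-! One step of the backward recursion: `V_t, ξ_t, d_t, K_t, l_t` and then `P_t, ζ_t, c_t`
from the coefficients `q = (P_{t+1}, ζ_{t+1}, c_{t+1})`. -/

/-- The argument `P_{t+1} e_{t+1} + ζ_{t+1}` of the conditional expectation in `ξ_t`. -/
def ξArg (t : ℕ) (q : QuadCoeff Ω n) : Ω → (Fin n → ℝ) := fun ω =>
  q.P ω *ᵥ S.e Pr u (t + 1) ω + q.ζ ω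

/-- The argument `c_{t+1} + e_{t+1}' P_{t+1} e_{t+1} + 2 e_{t+1}' ζ_{t+1}` of the conditional
expectation `d_t`. -/
def dArg (t : ℕ) (q : QuadCoeff Ω n) : Ω → ℝ := fun ω =>
  q.c ω + S.e Pr u (t + 1) ω ⬝ᵥ q.P ω *ᵥ S.e Pr u (t + 1) ω +
    2 * (S.e Pr u (t + 1) ω ⬝ᵥ q.ζ ω)

def stepV (μ : ℝ) (t : ℕ) (q : QuadCoeff Ω n) : Ω → Matrix (Fin n) (Fin n) ℝ := fun ω =>
  condMat Pr (S.F u t) q.P ω + S.Qμ Pr u μ t ω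

def stepξ (μ : ℝ) (t : ℕ) (q : QuadCoeff Ω n) : Ω → (Fin n → ℝ) := fun ω =>
  condVec Pr (S.F u t) (S.ξArg Pr u t q) ω + μ • S.m₃ Pr u t ω

def stepd (t : ℕ) (q : QuadCoeff Ω n) : Ω → ℝ :=
  condExp (S.F u t) Pr (S.dArg Pr u t q)

/-- The matrix `B' V_t B + R`. -/
def stepH (μ : ℝ) (t : ℕ) (q : QuadCoeff Ω n) : Ω → Matrix (Fin p) (Fin p) ℝ := fun ω =>
  S.Bᵀ * S.stepV Pr u μ t q ω * S.B + S.R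

def stepK (μ : ℝ) (t : ℕ) (q : QuadCoeff Ω n) : Ω → Matrix (Fin p) (Fin n) ℝ := fun ω =>
  -((S.stepH Pr u μ t q ω)⁻¹ * S.Bᵀ * S.stepV Pr u μ t q ω * S.A)

def stepl (μ : ℝ) (t : ℕ) (q : QuadCoeff Ω n) : Ω → (Fin p → ℝ) := fun ω =>
  -(((S.stepH Pr u μ t q ω)⁻¹ * S.Bᵀ) *ᵥ
    (S.stepξ Pr u μ t q ω + S.stepV Pr u μ t q ω *ᵥ S.wbar Pr))

def step (μ : ℝ) (t : ℕ) (q : QuadCoeff Ω n) : QuadCoeff Ω n where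
  P := fun ω =>
    (S.A + S.B * S.stepK Pr u μ t q ω)ᵀ * S.stepV Pr u μ t q ω *
        (S.A + S.B * S.stepK Pr u μ t q ω) +
      (S.stepK Pr u μ t q ω)ᵀ * S.R * S.stepK Pr u μ t q ω
  ζ := fun ω =>
    (S.A + S.B * S.stepK Pr u μ t q ω)ᵀ *ᵥ
      (S.stepξ Pr u μ t q ω + S.stepV Pr u μ t q ω *ᵥ S.wbar Pr)
  c := fun ω =>
    S.stepd Pr u t q ω + S.wbar Pr ⬝ᵥ S.stepV Pr u μ t q ω *ᵥ S.wbar Pr -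
        S.stepl Pr u μ t q ω ⬝ᵥ S.stepH Pr u μ t q ω *ᵥ S.stepl Pr u μ t q ω +
      2 * (S.stepξ Pr u μ t q ω ⬝ᵥ S.wbar Pr)

/-- The coefficients `(P_t, ζ_t, c_t)`, by backward recursion from zero at `t = N`. -/
def coeff (μ : ℝ) (t : ℕ) : QuadCoeff Ω n :=
  if t < S.N then S.step Pr u μ t (coeff μ (t + 1))
  else ⟨fun _ => 0, fun _ => 0, fun _ => 0⟩
termination_by S.N - t

/-- The feedback gain `K_t`. -/
def K (μ : ℝ) (t : ℕ) : Ω → Matrix (Fin p) (Fin n) ℝ :=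
  S.stepK Pr u μ t (S.coeff Pr u μ (t + 1))

/-- The affine term `l_t`. -/
def l (μ : ℝ) (t : ℕ) : Ω → (Fin p → ℝ) :=
  S.stepl Pr u μ t (S.coeff Pr u μ (t + 1))

/-- The quadratic function `x̂_{t|t}' P_t x̂_{t|t} + 2 ζ_t' x̂_{t|t} + c_t` of the estimate. -/
def quadValue (μ : ℝ) (t : ℕ) : Ω → ℝ := fun ω =>
  S.xEst Pr u t ω ⬝ᵥ (S.coeff Pr u μ t).P ω *ᵥ S.xEst Pr u t ω +
    2 * ((S.coeff Pr u μ t).ζ ω ⬝ᵥ S.xEst Pr u t ω) + (S.coeff Pr u μ t).c ω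

/-- All expectations in the Lagrangian and in the cost-to-go under `u` are expectations of
integrable random variables. -/
def CostsWellDefined (μ : ℝ) : Prop :=
  Integrable (S.lqCost u) Pr ∧ Integrable (S.riskCost Pr u) Pr ∧
    ∀ t < S.N, Integrable (S.m₄Arg Pr u t) Pr ∧ Integrable (S.g Pr u μ t) Pr

/-- At every stage of the backward recursion under `u`, the conditional expectations are those
of integrable random variables and `B' V_t B + R` is almost surely invertible. -/
def RecursionWellDefined (μ : ℝ) : Prop :=
  ∀ t < S.N,
    (∀ i, Integrable (fun ω => S.x u t ω i) Pr) ∧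
    (∀ i, Integrable (fun ω => S.x u (t + 1) ω i) Pr) ∧
    (∀ i j, Integrable (fun ω => S.δ Pr u (t + 1) ω i * S.δ Pr u (t + 1) ω j) Pr) ∧
    (∀ i, Integrable (fun ω =>
      (S.δ Pr u (t + 1) ω ⬝ᵥ S.Q *ᵥ S.δ Pr u (t + 1) ω) * S.δ Pr u (t + 1) ω i) Pr) ∧
    (∀ i j, Integrable (fun ω => (S.coeff Pr u μ (t + 1)).P ω i j) Pr) ∧
    (∀ i, Integrable (fun ω => S.ξArg Pr u t (S.coeff Pr u μ (t + 1)) ω i) Pr) ∧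
    Integrable (S.dArg Pr u t (S.coeff Pr u μ (t + 1))) Pr ∧
    ∀ᵐ ω ∂Pr, IsUnit (S.stepH Pr u μ t (S.coeff Pr u μ (t + 1)) ω)

end Control

end LQSystem

end

/-!
The system is linear, so the state splits as `x_t = x⁰_t + ctrl_t`, where `x⁰` is the state under
the input zero and `ctrl` is the contribution of the input. A causal input can be subtracted from
the outputs by whoever knows the information, hence every admissible input generates the same
information `F_t` as the input zero (`info_eq_info_zero`, `Admissible.F_eq`): there is no dual
effect. Consequently the prediction errors `δ_t`, the refinement errors `e_t`, the conditional
moments `W_t`, `m_{3,t}` and all coefficients `P_t, ζ_t, c_t, K_t, l_t` are, up to null sets, the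
same for all admissible inputs (`Admissible.coeff_eq`, `Admissible.gains_eq`).

Those quantities have moments of every order. The random variables with that property form an
algebra `momAlg` that is stable under conditional expectation; the only operation of the recursion
that leaves polynomial expressions is the inverse of `B' V_t B + R`, whose entries are bounded in
terms of `R` because `B' V_t B ⪰ 0` (`exists_bound_inv_add`, `condMat_posSemidef`). Inputs and
states lie in `L⁴`, and a quadratic form in `L⁴` variables with a coefficient matrix over `momAlg`
is integrable.

The optimality statement is a completion of squares (`completion_of_squares`): with `L_t =
x̂_{t|t}' P_t x̂_{t|t} + 2 ζ_t' x̂_{t|t} + c_t`, every admissible input satisfies `g_t + E(L_{t+1}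
| F_t) = L_t + loss_t`, where `loss_t ≥ 0` is the square of `u_t - (K_t x̂_{t|t} + l_t)` weighted
by `B' V_t B + R` (`Admissible.g_add_condExp_quadValue`). Summing, the conditional cost from stage
`t` on is `L_t` plus the expected losses (`Admissible.costFrom_eq`), and the Lagrangian is a
constant plus the expected losses (`Admissible.lagrangian_eq`). This gives the lower bounds, and
the optimality of every admissible input that obeys the feedback law.

It remains to make the losses vanish. The product of the unbounded gain `K_t` with an estimate
that is merely in `L⁴` need not be in `L⁴`, so after arbitrary past inputs the feedback law may be
inadmissible. It becomes admissible when it is switched on only on an event of `F_t` on which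
`x̂_{t|t}` is bounded (`Admissible.gatedInput`): there the state has moments of every order, since
the estimation error has, and the closed loop preserves this. These events exhaust the sample
space, which identifies the essential infimum (`Admissible.isOptimalCostToGo`). At stage `0` the
state is deterministic and no restriction is needed, which gives the optimal input
(`Standing.exists_feedback`).
-/

noncomputable section

/-! ### Algebras of random variables -/

section Entries

variable {Ω : Type*} {k l r : ℕ}

/-- The coordinates of a random vector belong to the algebra `𝓐` of random variables. -/
def CoordsIn (𝓐 : Subalgebra ℝ (Ω → ℝ)) (Z : Ω → Fin k → ℝ) : Prop :=
  ∀ i, (fun ω => Z ω i) ∈ 𝓐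

/-- The entries of a random matrix belong to the algebra `𝓐` of random variables. -/
def EntriesIn (𝓐 : Subalgebra ℝ (Ω → ℝ)) (M : Ω → Matrix (Fin k) (Fin l) ℝ) : Prop :=
  ∀ i j, (fun ω => M ω i j) ∈ 𝓐

variable {𝓐 : Subalgebra ℝ (Ω → ℝ)}

theorem const_mem_alg (c : ℝ) : (fun _ => c) ∈ 𝓐 := 𝓐.algebraMap_mem c

theorem sum_mem_alg {ι : Type*} {s : Finset ι} {f : ι → Ω → ℝ} (h : ∀ i ∈ s, f i ∈ 𝓐) :
    (fun ω => ∑ i ∈ s, f i ω) ∈ 𝓐 := by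
  have := sum_mem h
  convert this using 1
  ext ω
  simp

theorem dotProduct_mem_alg {Z Y : Ω → Fin k → ℝ} (hZ : CoordsIn 𝓐 Z) (hY : CoordsIn 𝓐 Y) :
    (fun ω => Z ω ⬝ᵥ Y ω) ∈ 𝓐 :=
  sum_mem_alg fun i _ => 𝓐.mul_mem (hZ i) (hY i)

namespace CoordsIn

theorem const (z : Fin k → ℝ) : CoordsIn 𝓐 fun _ => z := fun i => const_mem_alg (z i)

theorem add {Z Y : Ω → Fin k → ℝ} (hZ : CoordsIn 𝓐 Z) (hY : CoordsIn 𝓐 Y) :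
    CoordsIn 𝓐 fun ω => Z ω + Y ω := fun i => 𝓐.add_mem (hZ i) (hY i)

theorem sub {Z Y : Ω → Fin k → ℝ} (hZ : CoordsIn 𝓐 Z) (hY : CoordsIn 𝓐 Y) :
    CoordsIn 𝓐 fun ω => Z ω - Y ω := fun i => 𝓐.sub_mem (hZ i) (hY i)

theorem neg {Z : Ω → Fin k → ℝ} (hZ : CoordsIn 𝓐 Z) :
    CoordsIn 𝓐 fun ω => -Z ω := fun i => 𝓐.neg_mem (hZ i)

theorem smul {f : Ω → ℝ} {Z : Ω → Fin k → ℝ} (hf : f ∈ 𝓐) (hZ : CoordsIn 𝓐 Z) :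
    CoordsIn 𝓐 fun ω => f ω • Z ω := fun i => 𝓐.mul_mem hf (hZ i)

theorem vecMulVec {Z : Ω → Fin k → ℝ} {Y : Ω → Fin l → ℝ} (hZ : CoordsIn 𝓐 Z)
    (hY : CoordsIn 𝓐 Y) : EntriesIn 𝓐 fun ω => Matrix.vecMulVec (Z ω) (Y ω) :=
  fun i j => 𝓐.mul_mem (hZ i) (hY j)

end CoordsIn

namespace EntriesIn

theorem const (M : Matrix (Fin k) (Fin l) ℝ) : EntriesIn 𝓐 fun _ : Ω => M :=
  fun i j => const_mem_alg (M i j)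

theorem add {M M' : Ω → Matrix (Fin k) (Fin l) ℝ} (hM : EntriesIn 𝓐 M) (hM' : EntriesIn 𝓐 M') :
    EntriesIn 𝓐 fun ω => M ω + M' ω := fun i j => 𝓐.add_mem (hM i j) (hM' i j)

theorem neg {M : Ω → Matrix (Fin k) (Fin l) ℝ} (hM : EntriesIn 𝓐 M) :
    EntriesIn 𝓐 fun ω => -M ω := fun i j => 𝓐.neg_mem (hM i j)

theorem transpose {M : Ω → Matrix (Fin k) (Fin l) ℝ} (hM : EntriesIn 𝓐 M) :
    EntriesIn 𝓐 fun ω => (M ω)ᵀ := fun i j => hM j i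

theorem mul {M : Ω → Matrix (Fin k) (Fin l) ℝ} {M' : Ω → Matrix (Fin l) (Fin r) ℝ}
    (hM : EntriesIn 𝓐 M) (hM' : EntriesIn 𝓐 M') : EntriesIn 𝓐 fun ω => M ω * M' ω :=
  fun i j => dotProduct_mem_alg (Z := fun ω => M ω i) (Y := fun ω a => M' ω a j) (hM i)
    fun a => hM' a j

theorem const_smul (c : ℝ) {M : Ω → Matrix (Fin k) (Fin l) ℝ} (hM : EntriesIn 𝓐 M) :
    EntriesIn 𝓐 fun ω => c • M ω := fun i j => 𝓐.smul_mem (hM i j) c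

theorem mulVec {M : Ω → Matrix (Fin k) (Fin l) ℝ} {Z : Ω → Fin l → ℝ} (hM : EntriesIn 𝓐 M)
    (hZ : CoordsIn 𝓐 Z) : CoordsIn 𝓐 fun ω => M ω *ᵥ Z ω :=
  fun i => dotProduct_mem_alg (Z := fun ω => M ω i) (hM i) hZ

end EntriesIn

theorem quadForm_mem_alg {Z : Ω → Fin k → ℝ} {M : Ω → Matrix (Fin k) (Fin k) ℝ}
    (hZ : CoordsIn 𝓐 Z) (hM : EntriesIn 𝓐 M) : (fun ω => Z ω ⬝ᵥ M ω *ᵥ Z ω) ∈ 𝓐 :=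
  dotProduct_mem_alg hZ (hM.mulVec hZ)

end Entries

section Algebras

variable {Ω : Type*}

/-- The algebra of real random variables that are measurable with respect to `m`. -/
def measAlg (m : MeasurableSpace Ω) : Subalgebra ℝ (Ω → ℝ) where
  carrier := {f | Measurable[m] f}
  mul_mem' hf hg := Measurable.mul hf hg
  add_mem' hf hg := Measurable.add hf hg
  algebraMap_mem' _ := measurable_const

theorem mem_measAlg {m : MeasurableSpace Ω} {f : Ω → ℝ} : f ∈ measAlg m ↔ Measurable[m] f :=
  Iff.rfl

theorem inv_entriesIn_measAlg {m : MeasurableSpace Ω} {k : ℕ} {H : Ω → Matrix (Fin k) (Fin k) ℝ}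
    (hH : EntriesIn (measAlg m) H) : EntriesIn (measAlg m) fun ω => (H ω)⁻¹ := fun i j => by
  let H' : Ω → Fin k → Fin k → ℝ := H
  have hmeas : Measurable H' :=
    measurable_pi_lambda _ fun i => measurable_pi_lambda _ fun j => hH i j
  have hdet : Measurable fun M : Fin k → Fin k → ℝ => Matrix.det (Matrix.of M) := by
    refine Continuous.measurable ?_
    exact Continuous.matrix_det continuous_id
  have hadj : Measurable fun M : Fin k → Fin k → ℝ => Matrix.adjugate (Matrix.of M) i j := by
    refine Continuous.measurable ?_
    exact (Continuous.matrix_adjugate continuous_id).matrix_elem i j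
  have h := (hdet.inv.mul hadj).comp hmeas
  refine mem_measAlg.2 ?_
  convert h using 2 with ω
  simp only [Matrix.inv_def, Ring.inverse_eq_inv', Matrix.smul_apply, smul_eq_mul]
  rfl

variable {m : MeasurableSpace Ω} [m0 : MeasurableSpace Ω] {Pr : Measure Ω}

/-! ### Conditional expectation of random vectors and matrices -/

theorem condExp_mem_measAlg (f : Ω → ℝ) :
    condExp m Pr f ∈ measAlg m := stronglyMeasurable_condExp.measurable

theorem condVec_coordsIn_measAlg {k : ℕ} (Z : Ω → Fin k → ℝ) :
    CoordsIn (measAlg m) (condVec Pr m Z) := fun _ => condExp_mem_measAlg _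

theorem condMat_entriesIn_measAlg {k l : ℕ}
    (Z : Ω → Matrix (Fin k) (Fin l) ℝ) :
    EntriesIn (measAlg m) (condMat Pr m Z) := fun _ _ => condExp_mem_measAlg _

theorem condVec_congr_ae {k : ℕ} {Z Y : Ω → Fin k → ℝ}
    (h : Z =ᵐ[Pr] Y) : condVec Pr m Z =ᵐ[Pr] condVec Pr m Y := by
  have : ∀ i, condExp m Pr (fun ω => Z ω i) =ᵐ[Pr] condExp m Pr (fun ω => Y ω i) := fun i =>
    condExp_congr_ae (h.mono fun ω hω => by simp [hω])
  filter_upwards [ae_all_iff.2 this] with ω hω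
  exact funext hω

theorem condMat_congr_ae {k l : ℕ} {Z Y : Ω → Matrix (Fin k) (Fin l) ℝ}
    (h : Z =ᵐ[Pr] Y) : condMat Pr m Z =ᵐ[Pr] condMat Pr m Y := by
  have : ∀ i j, condExp m Pr (fun ω => Z ω i j) =ᵐ[Pr] condExp m Pr (fun ω => Y ω i j) :=
    fun i j => condExp_congr_ae (h.mono fun ω hω => by simp [hω])
  filter_upwards [ae_all_iff.2 fun i => ae_all_iff.2 (this i)] with ω hω
  ext i j
  exact hω i j

theorem condExp_fun_sum {ι : Type*} {s : Finset ι} {f : ι → Ω → ℝ}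
    (hf : ∀ i ∈ s, Integrable (f i) Pr) :
    condExp m Pr (fun ω => ∑ i ∈ s, f i ω) =ᵐ[Pr] fun ω => ∑ i ∈ s, condExp m Pr (f i) ω := by
  have h1 : (fun ω => ∑ i ∈ s, f i ω) = ∑ i ∈ s, f i := by ext ω; simp
  have h2 : (fun ω => ∑ i ∈ s, condExp m Pr (f i) ω) = ∑ i ∈ s, condExp m Pr (f i) := by
    ext ω; simp
  rw [h1, h2]
  exact condExp_finsetSum hf m

theorem condExp_fun_mul {f g : Ω → ℝ} (hf : Measurable[m] f)
    (hfg : Integrable (fun ω => f ω * g ω) Pr) (hg : Integrable g Pr) :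
    condExp m Pr (fun ω => f ω * g ω) =ᵐ[Pr] fun ω => f ω * condExp m Pr g ω :=
  condExp_mul_of_stronglyMeasurable_left (f := f) (g := g) hf.stronglyMeasurable hfg hg

theorem quadForm_eq_sum {k : ℕ} (s : Fin k → ℝ) (M : Matrix (Fin k) (Fin k) ℝ) :
    s ⬝ᵥ M *ᵥ s = ∑ i, ∑ j, s i * s j * M i j := by
  simp only [dotProduct, Matrix.mulVec, Finset.mul_sum]
  exact Finset.sum_congr rfl fun i _ => Finset.sum_congr rfl fun j _ => by ring

theorem condExp_dotProduct {k : ℕ} {s Z : Ω → Fin k → ℝ}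
    (hs : CoordsIn (measAlg m) s) (hsZ : ∀ i, Integrable (fun ω => s ω i * Z ω i) Pr)
    (hZ : ∀ i, Integrable (fun ω => Z ω i) Pr) :
    condExp m Pr (fun ω => s ω ⬝ᵥ Z ω) =ᵐ[Pr] fun ω => s ω ⬝ᵥ condVec Pr m Z ω := by
  refine (condExp_fun_sum (fun i _ => hsZ i)).trans ?_
  filter_upwards [ae_all_iff.2 fun i => condExp_fun_mul (hs i) (hsZ i) (hZ i)] with ω hω
  exact Finset.sum_congr rfl fun i _ => hω i

theorem condExp_quadForm {k : ℕ} {s : Ω → Fin k → ℝ}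
    {M : Ω → Matrix (Fin k) (Fin k) ℝ} (hs : CoordsIn (measAlg m) s)
    (hsM : ∀ i j, Integrable (fun ω => s ω i * s ω j * M ω i j) Pr)
    (hM : ∀ i j, Integrable (fun ω => M ω i j) Pr) :
    condExp m Pr (fun ω => s ω ⬝ᵥ M ω *ᵥ s ω) =ᵐ[Pr] fun ω => s ω ⬝ᵥ condMat Pr m M ω *ᵥ s ω := by
  simp only [quadForm_eq_sum]
  refine (condExp_fun_sum (fun i _ => integrable_finsetSum _ fun j _ => hsM i j)).trans ?_
  filter_upwards [ae_all_iff.2 fun i => condExp_fun_sum (fun j _ => hsM i j),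
    ae_all_iff.2 fun i => ae_all_iff.2 fun j =>
      condExp_fun_mul ((measAlg m).mul_mem (hs i) (hs j)) (hsM i j) (hM i j)] with ω h1 h2
  refine Finset.sum_congr rfl fun i _ => (h1 i).trans (Finset.sum_congr rfl fun j _ => h2 i j)

/-- Conditional expectation preserves positive semidefiniteness.  For a fixed vector `a` the form
`a' E(Z | m) a = E(a' Z a | m)` is almost surely nonnegative; a countable dense set of vectors
gives one null set that serves all vectors. -/
theorem condMat_posSemidef {k : ℕ} {Z : Ω → Matrix (Fin k) (Fin k) ℝ}
    (hZ : ∀ i j, Integrable (fun ω => Z ω i j) Pr) (hpos : ∀ᵐ ω ∂Pr, (Z ω).PosSemidef) :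
    ∀ᵐ ω ∂Pr, (condMat Pr m Z ω).PosSemidef := by
  have hsymm : ∀ i j, condExp m Pr (fun ω => Z ω i j) =ᵐ[Pr] condExp m Pr (fun ω => Z ω j i) :=
    fun i j => condExp_congr_ae (hpos.mono fun ω hω => by
      simpa using congrFun (congrFun hω.isHermitian j) i)
  have hquad : ∀ a : Fin k → ℝ, ∀ᵐ ω ∂Pr, 0 ≤ a ⬝ᵥ condMat Pr m Z ω *ᵥ a := fun a => by
    have h1 := condExp_quadForm (m := m) (s := fun _ => a) (CoordsIn.const a)
      (fun i j => (hZ i j).const_mul (a i * a j)) hZ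
    have h2 : 0 ≤ᵐ[Pr] condExp m Pr (fun ω => a ⬝ᵥ Z ω *ᵥ a) :=
      condExp_nonneg (hpos.mono fun ω hω => by simpa using hω.dotProduct_mulVec_nonneg a)
    filter_upwards [h1, h2] with ω e1 e2
    rw [← e1]
    exact e2
  filter_upwards [ae_all_iff.2 fun i => ae_all_iff.2 fun j => hsymm i j,
    ae_all_iff.2 fun i => hquad (TopologicalSpace.denseSeq (Fin k → ℝ) i)] with ω h1 h2
  refine Matrix.PosSemidef.of_dotProduct_mulVec_nonneg (Matrix.IsHermitian.ext fun i j => ?_)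
    fun x => ?_
  · simpa [condMat] using h1 j i
  · have hcl : IsClosed {a : Fin k → ℝ | 0 ≤ a ⬝ᵥ condMat Pr m Z ω *ᵥ a} :=
      isClosed_le continuous_const (by fun_prop)
    have : x ∈ {a : Fin k → ℝ | 0 ≤ a ⬝ᵥ condMat Pr m Z ω *ᵥ a} :=
      hcl.closure_subset_iff.2 (Set.range_subset_iff.2 h2)
        (TopologicalSpace.denseRange_denseSeq (Fin k → ℝ) x)
    simpa using this

/-! ### Moments of every order -/

/-- The algebra of real random variables that have finite moments of every order. -/
def momAlg (Pr : Measure Ω) [IsProbabilityMeasure Pr] : Subalgebra ℝ (Ω → ℝ) where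
  carrier := {f | ∀ q : ℕ, MemLp f q Pr}
  mul_mem' {f g} hf hg q := by
    have : ENNReal.HolderTriple ((2 * q : ℕ) : ENNReal) ((2 * q : ℕ) : ENNReal) (q : ENNReal) :=
      ⟨by
        push_cast
        rw [ENNReal.mul_inv (by simp) (by simp), ← add_mul, ENNReal.inv_two_add_inv_two, one_mul]⟩
    exact (hg (2 * q)).mul (hf (2 * q))
  add_mem' hf hg q := (hf q).add (hg q)
  algebraMap_mem' c _ := memLp_const c

variable [IsProbabilityMeasure Pr]

theorem momAlg_congr {f g : Ω → ℝ} (hf : f ∈ momAlg Pr) (h : f =ᵐ[Pr] g) : g ∈ momAlg Pr :=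
  fun q => (hf q).ae_eq h

theorem memLp_four_of_mem_momAlg {f : Ω → ℝ} (hf : f ∈ momAlg Pr) : MemLp f 4 Pr := by
  simpa using hf 4

theorem integrable_of_mem_momAlg {f : Ω → ℝ} (hf : f ∈ momAlg Pr) : Integrable f Pr :=
  memLp_one_iff_integrable.1 (by simpa using hf 1)

theorem integrable_of_memLp_four {f : Ω → ℝ} (hf : MemLp f 4 Pr) : Integrable f Pr :=
  hf.integrable (by norm_num)

theorem condExp_mem_momAlg {f : Ω → ℝ} (hf : f ∈ momAlg Pr) :
    condExp m Pr f ∈ momAlg Pr := fun q => by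
  have : MemLp (condExp m Pr f) ((q + 1 : ℕ) : ENNReal) Pr :=
    (hf (q + 1)).condExp (by push_cast; exact le_add_self)
  exact this.mono_exponent (by push_cast; exact le_self_add)

theorem condVec_coordsIn_momAlg {k : ℕ} {Z : Ω → Fin k → ℝ}
    (hZ : CoordsIn (momAlg Pr) Z) : CoordsIn (momAlg Pr) (condVec Pr m Z) :=
  fun i => condExp_mem_momAlg (hZ i)

theorem condMat_entriesIn_momAlg {k l : ℕ}
    {Z : Ω → Matrix (Fin k) (Fin l) ℝ} (hZ : EntriesIn (momAlg Pr) Z) :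
    EntriesIn (momAlg Pr) (condMat Pr m Z) :=
  fun i j => condExp_mem_momAlg (hZ i j)

/-- A random variable with all moments may be multiplied with two random variables in `L⁴`. -/
theorem integrable_mul_of_memLp_four {f g h : Ω → ℝ} (hf : f ∈ momAlg Pr) (hg : MemLp g 4 Pr)
    (hh : MemLp h 4 Pr) : Integrable (fun ω => g ω * h ω * f ω) Pr := by
  have : ENNReal.HolderTriple 4 4 2 := ⟨by
    rw [← two_mul, show (4 : ENNReal) = 2 * 2 by norm_num, ENNReal.mul_inv (by simp) (by simp),
      ← mul_assoc, ENNReal.mul_inv_cancel (by simp) (by simp), one_mul]⟩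
  have h1 : MemLp (fun ω => g ω * h ω) 2 Pr := hh.mul' hg
  have h2 : MemLp f 2 Pr := by simpa using hf 2
  exact h1.integrable_mul h2

theorem integrable_mul_momAlg {f g : Ω → ℝ} (hf : f ∈ momAlg Pr) (hg : MemLp g 4 Pr) :
    Integrable (fun ω => g ω * f ω) Pr := by
  simpa using integrable_mul_of_memLp_four hf hg (memLp_const (1 : ℝ))

theorem integrable_dotProduct {k : ℕ} {s Z : Ω → Fin k → ℝ}
    (hs : ∀ i, MemLp (fun ω => s ω i) 4 Pr) (hZ : CoordsIn (momAlg Pr) Z) :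
    Integrable (fun ω => s ω ⬝ᵥ Z ω) Pr :=
  integrable_finsetSum _ fun i _ => integrable_mul_momAlg (hZ i) (hs i)

theorem integrable_quadForm {k : ℕ} {s : Ω → Fin k → ℝ} {M : Ω → Matrix (Fin k) (Fin k) ℝ}
    (hs : ∀ i, MemLp (fun ω => s ω i) 4 Pr) (hM : EntriesIn (momAlg Pr) M) :
    Integrable (fun ω => s ω ⬝ᵥ M ω *ᵥ s ω) Pr := by
  simp only [quadForm_eq_sum]
  exact integrable_finsetSum _ fun i _ => integrable_finsetSum _ fun j _ =>
    integrable_mul_of_memLp_four (hM i j) (hs i) (hs j)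

/-! ### Inverses of matrices bounded below -/

/-- The inverse of a matrix that dominates the positive definite matrix `R` has entries bounded in
terms of `R` alone.  With `z` the `j`-th column of the inverse, positivity of `R` at `z - s R⁻¹ eᵢ`
gives `zᵢ² ≤ (R⁻¹)ᵢᵢ z' R z ≤ (R⁻¹)ᵢᵢ zⱼ`. -/
theorem exists_bound_inv_add {k : ℕ} {R : Matrix (Fin k) (Fin k) ℝ} (hR : R.PosDef) :
    ∃ C : ℝ, ∀ D : Matrix (Fin k) (Fin k) ℝ, D.PosSemidef → ∀ i j, |(D + R)⁻¹ i j| ≤ C := by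
  have key : ∀ D : Matrix (Fin k) (Fin k) ℝ, D.PosSemidef → ∀ i j,
      ((D + R)⁻¹ i j) ^ 2 ≤ R⁻¹ i i * (D + R)⁻¹ j j := fun D hD i j => by
    have hH : (D + R).PosDef := Matrix.PosDef.posSemidef_add hD hR
    have hρ : 0 < R⁻¹ i i := by
      have := hR.inv.dotProduct_mulVec_pos (x := Pi.single i 1) (by simp)
      simpa using this
    set z : Fin k → ℝ := (D + R)⁻¹ *ᵥ Pi.single j 1 with hz
    set b : Fin k → ℝ := R⁻¹ *ᵥ Pi.single i 1 with hb
    have hzi : ∀ i, z i = (D + R)⁻¹ i j := fun i => by simp [hz]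
    have hHz : (D + R) *ᵥ z = Pi.single j 1 := by
      rw [hz, Matrix.mulVec_mulVec, Matrix.mul_nonsing_inv _
        ((Matrix.isUnit_iff_isUnit_det _).1 hH.isUnit), Matrix.one_mulVec]
    have hRb : R *ᵥ b = Pi.single i 1 := by
      rw [hb, Matrix.mulVec_mulVec, Matrix.mul_nonsing_inv _
        ((Matrix.isUnit_iff_isUnit_det _).1 hR.isUnit), Matrix.one_mulVec]
    have hDz : 0 ≤ z ⬝ᵥ D *ᵥ z := by simpa using hD.dotProduct_mulVec_nonneg z
    have hzH : z ⬝ᵥ D *ᵥ z + z ⬝ᵥ R *ᵥ z = z j := by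
      rw [← dotProduct_add, ← Matrix.add_mulVec, hHz]
      simp
    have hbi : b i = R⁻¹ i i := by simp [hb]
    have hRt : Rᵀ = R := by simpa using hR.isHermitian.eq
    have hbz : b ⬝ᵥ R *ᵥ z = z i := by
      rw [Matrix.dotProduct_mulVec, ← Matrix.mulVec_transpose, hRt, hRb]
      simp
    have hpos : 0 ≤ (z - (z i / R⁻¹ i i) • b) ⬝ᵥ R *ᵥ (z - (z i / R⁻¹ i i) • b) := by
      simpa using hR.posSemidef.dotProduct_mulVec_nonneg (z - (z i / R⁻¹ i i) • b)
    rw [Matrix.mulVec_sub, Matrix.mulVec_smul, sub_dotProduct, dotProduct_sub, dotProduct_sub,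
      smul_dotProduct, smul_dotProduct, dotProduct_smul, dotProduct_smul, hRb, hbz] at hpos
    simp only [dotProduct_single, mul_one, smul_eq_mul, hbi] at hpos
    have e1 : z i / R⁻¹ i i * (z i / R⁻¹ i i * R⁻¹ i i) = z i / R⁻¹ i i * z i := by
      field_simp
    rw [e1] at hpos
    have h2 : z i / R⁻¹ i i * z i ≤ z j := by linarith
    rw [← hzi, ← hzi]
    calc z i ^ 2 = R⁻¹ i i * (z i / R⁻¹ i i * z i) := by field_simp
      _ ≤ R⁻¹ i i * z j := by gcongr
  have hρ : ∀ i, 0 ≤ R⁻¹ i i := fun i => hR.inv.posSemidef.diag_nonneg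
  refine ⟨∑ i, R⁻¹ i i, fun D hD i j => ?_⟩
  have hle : ∀ i, R⁻¹ i i ≤ ∑ i, R⁻¹ i i := fun i =>
    Finset.single_le_sum (f := fun i => R⁻¹ i i) (fun i _ => hρ i) (Finset.mem_univ i)
  have hj : (D + R)⁻¹ j j ≤ R⁻¹ j j := by
    by_contra! h
    have := key D hD j j
    nlinarith [hρ j]
  refine abs_le_of_sq_le_sq ((key D hD i j).trans ?_) ((hρ i).trans (hle i))
  rw [sq]
  exact mul_le_mul (hle i) (hj.trans (hle j))
    ((Matrix.PosDef.posSemidef_add hD hR).inv.posSemidef.diag_nonneg) ((hρ i).trans (hle i))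

theorem inv_add_entriesIn_momAlg (hm : m ≤ m0) {k : ℕ} {R : Matrix (Fin k) (Fin k) ℝ}
    (hR : R.PosDef) {D : Ω → Matrix (Fin k) (Fin k) ℝ} (hD : EntriesIn (measAlg m) D)
    (hpos : ∀ᵐ ω ∂Pr, (D ω).PosSemidef) :
    EntriesIn (momAlg Pr) fun ω => (D ω + R)⁻¹ := fun i j q => by
  obtain ⟨C, hC⟩ := exists_bound_inv_add hR
  have hmeas := inv_entriesIn_measAlg (hD.add (EntriesIn.const R)) i j
  exact MemLp.of_bound (hmeas.mono hm le_rfl).aestronglyMeasurable C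
    (hpos.mono fun ω hω => hC _ hω i j)

end Algebras

/-! ### Linear maps, indicators and sums of random vectors -/

theorem measurable_matrix_mulVec {Ω : Type*} {m : MeasurableSpace Ω} {k l : ℕ}
    (M : Matrix (Fin k) (Fin l) ℝ) {Z : Ω → Fin l → ℝ} (hZ : Measurable Z) :
    Measurable fun ω => M *ᵥ Z ω :=
  (Continuous.matrix_mulVec continuous_const continuous_id).measurable.comp hZ

theorem condVec_add {Ω : Type*} {m : MeasurableSpace Ω} [m0 : MeasurableSpace Ω] {Pr : Measure Ω}
    {k : ℕ} {Z Y : Ω → Fin k → ℝ} (hZ : ∀ i, Integrable (fun ω => Z ω i) Pr)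
    (hY : ∀ i, Integrable (fun ω => Y ω i) Pr) :
    condVec Pr m (fun ω => Z ω + Y ω) =ᵐ[Pr] fun ω => condVec Pr m Z ω + condVec Pr m Y ω := by
  filter_upwards [ae_all_iff.2 fun i => condExp_add (hZ i) (hY i) m] with ω hω
  exact funext hω

theorem condVec_of_measurable {Ω : Type*} {m : MeasurableSpace Ω} [m0 : MeasurableSpace Ω]
    {Pr : Measure Ω} [IsFiniteMeasure Pr] (hm : m ≤ m0) {k : ℕ} {Y : Ω → Fin k → ℝ}
    (hY : ∀ i, Integrable (fun ω => Y ω i) Pr)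
    (hYm : CoordsIn (measAlg m) Y) : condVec Pr m Y = Y := by
  funext ω i
  exact congrFun (condExp_of_stronglyMeasurable hm (hYm i).stronglyMeasurable (hY i)) ω

theorem condVec_add_measurable {Ω : Type*} {m : MeasurableSpace Ω} [m0 : MeasurableSpace Ω]
    {Pr : Measure Ω} [IsFiniteMeasure Pr] (hm : m ≤ m0) {k : ℕ} {Z Y : Ω → Fin k → ℝ}
    (hZ : ∀ i, Integrable (fun ω => Z ω i) Pr) (hY : ∀ i, Integrable (fun ω => Y ω i) Pr)
    (hYm : CoordsIn (measAlg m) Y) :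
    condVec Pr m (fun ω => Z ω + Y ω) =ᵐ[Pr] fun ω => condVec Pr m Z ω + Y ω := by
  have h := condVec_add (m := m) hZ hY
  rwa [condVec_of_measurable hm hY hYm] at h

theorem condVec_mulVec {Ω : Type*} {m : MeasurableSpace Ω} [m0 : MeasurableSpace Ω]
    {Pr : Measure Ω} {k l : ℕ} (M : Matrix (Fin k) (Fin l) ℝ) {Z : Ω → Fin l → ℝ}
    (hZ : ∀ i, Integrable (fun ω => Z ω i) Pr) :
    condVec Pr m (fun ω => M *ᵥ Z ω) =ᵐ[Pr] fun ω => M *ᵥ condVec Pr m Z ω := by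
  filter_upwards [ae_all_iff.2 fun i => condExp_dotProduct (m := m) (s := fun _ => M i)
    (CoordsIn.const _) (fun j => (hZ j).const_mul _) hZ] with ω hω
  exact funext hω

theorem posSemidef_quadForm_nonneg {k : ℕ} {M : Matrix (Fin k) (Fin k) ℝ} (hM : M.PosSemidef)
    (z : Fin k → ℝ) : 0 ≤ z ⬝ᵥ M *ᵥ z := by simpa using hM.dotProduct_mulVec_nonneg z

theorem Matrix.PosSemidef.transpose_mul_mul_same {k l : ℕ} {V : Matrix (Fin k) (Fin k) ℝ}
    (hV : V.PosSemidef) (M : Matrix (Fin k) (Fin l) ℝ) : (Mᵀ * V * M).PosSemidef := by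
  simpa using hV.conjTranspose_mul_mul_same M

theorem indicator_mem_momAlg {Ω : Type*} [m0 : MeasurableSpace Ω] {Pr : Measure Ω}
    [IsProbabilityMeasure Pr] {Γ : Set Ω} (hΓ : MeasurableSet Γ) {k : ℕ} {Z : Ω → Fin k → ℝ}
    (hZ : CoordsIn (momAlg Pr) Z) : CoordsIn (momAlg Pr) (Γ.indicator Z) := fun i q => by
  have h := (hZ i q).indicator hΓ
  refine h.ae_eq (Filter.Eventually.of_forall fun ω => ?_)
  by_cases hω : ω ∈ Γ <;> simp [hω]

theorem condVec_indicator {Ω : Type*} {m : MeasurableSpace Ω} [m0 : MeasurableSpace Ω]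
    {Pr : Measure Ω} {Γ : Set Ω} (hΓ : MeasurableSet[m] Γ) {k : ℕ}
    {Z : Ω → Fin k → ℝ} (hZ : ∀ i, Integrable (fun ω => Z ω i) Pr) :
    ∀ᵐ ω ∂Pr, ω ∈ Γ → condVec Pr m (Γ.indicator Z) ω = condVec Pr m Z ω := by
  filter_upwards [ae_all_iff.2 fun i => condExp_indicator (hZ i) hΓ] with ω hω hmem
  funext i
  have h1 : (fun ω => Γ.indicator Z ω i) = Γ.indicator fun ω => Z ω i := by
    funext ω
    by_cases h : ω ∈ Γ <;> simp [h]
  simp only [condVec, h1, hω i, Set.indicator_of_mem hmem]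

namespace LQSystem

/-! ### Separation of the control from the noise -/

section Separation

variable {Ω : Type*} {n p m : ℕ} (S : LQSystem Ω n p m) (u : ℕ → Ω → (Fin p → ℝ))

/-- The part of the state that is caused by the input: `x_t = x⁰_t + ctrl_t`, where `x⁰` is the
state process under the input zero. -/
def ctrl : ℕ → Ω → (Fin n → ℝ)
  | 0 => fun _ => 0
  | t + 1 => fun ω => S.A *ᵥ ctrl t ω + S.B *ᵥ u t ω

theorem x_eq_add_ctrl (t : ℕ) (ω : Ω) : S.x u t ω = S.x 0 t ω + S.ctrl u t ω := by
  induction t with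
  | zero => simp [x, ctrl]
  | succ t ih =>
    simp only [x, ctrl, ih, Matrix.mulVec_add, Pi.zero_apply, Matrix.mulVec_zero, add_zero]
    abel

theorem y_eq_add_ctrl (t : ℕ) (ω : Ω) : S.y u t ω = S.y 0 t ω + S.C *ᵥ S.ctrl u t ω := by
  simp only [y, S.x_eq_add_ctrl u t ω, Matrix.mulVec_add]
  abel

theorem x_congr {u u' : ℕ → Ω → (Fin p → ℝ)} {t : ℕ}
    (h : ∀ s < t, u' s = u s) : S.x u' t = S.x u t := by
  induction t with
  | zero => rfl
  | succ t ih =>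
    funext ω
    simp only [x, ih fun s hs => h s (by omega), h t (by omega)]

variable {S u}

theorem measurable_ctrl {𝓖 : MeasurableSpace Ω} {t : ℕ} (hu : ∀ s < t, Measurable (u s)) :
    Measurable (S.ctrl u t) := by
  induction t with
  | zero => exact measurable_const
  | succ t ih =>
    exact (measurable_matrix_mulVec S.A (ih fun s hs => hu s (by omega))).add
      (measurable_matrix_mulVec S.B (hu t (by omega)))

theorem measurable_x {𝓖 : MeasurableSpace Ω} {t : ℕ} (hu : ∀ s < t, Measurable (u s))
    (hw : ∀ s ≤ t, Measurable (S.w s)) : Measurable (S.x u t) := by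
  induction t with
  | zero => exact measurable_const
  | succ t ih =>
    exact ((measurable_matrix_mulVec S.A (ih (fun s hs => hu s (by omega))
      fun s hs => hw s (by omega))).add
      (measurable_matrix_mulVec S.B (hu t (by omega)))).add (hw (t + 1) le_rfl)

theorem info_le_iff {𝓖 : MeasurableSpace Ω} {t : ℕ} :
    S.info u t ≤ 𝓖 ↔ (∀ s ≤ t, Measurable[𝓖] (S.y u s)) ∧ ∀ s < t, Measurable[𝓖] (u s) := by
  simp only [info, sup_le_iff, iSup_le_iff, measurable_iff_comap_le]

theorem measurable_y_info {s t : ℕ} (h : s ≤ t) : Measurable[S.info u t] (S.y u s) :=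
  (info_le_iff.1 le_rfl).1 s h

theorem measurable_u_info {s t : ℕ} (h : s < t) : Measurable[S.info u t] (u s) :=
  (info_le_iff.1 le_rfl).2 s h

theorem info_mono : Monotone (S.info u) := fun _ _ h =>
  info_le_iff.2 ⟨fun _ hr => measurable_y_info (hr.trans h),
    fun _ hr => measurable_u_info (hr.trans_le h)⟩

/-- There is no dual effect: an input that is causal with respect to the noise information leaves
the available information unchanged, because its contribution to the outputs can be added or
subtracted by the controller. -/
theorem info_eq_info_zero {t : ℕ} (hu : ∀ s < t, Measurable[S.info 0 s] (u s)) :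
    S.info u t = S.info 0 t := by
  have hC : ∀ 𝓖 : MeasurableSpace Ω, ∀ s ≤ t, (∀ r < t, Measurable[𝓖] (u r)) →
      Measurable[𝓖] fun ω => S.C *ᵥ S.ctrl u s ω := fun 𝓖 s hs h =>
    measurable_matrix_mulVec S.C (measurable_ctrl fun r hr => h r (hr.trans_le hs))
  refine le_antisymm (info_le_iff.2 ?_) (info_le_iff.2 ?_)
  · have hu' : ∀ s < t, Measurable[S.info 0 t] (u s) := fun s hs =>
      (hu s hs).mono (info_mono hs.le) le_rfl
    refine ⟨fun s hs => ?_, hu'⟩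
    rw [show S.y u s = fun ω => S.y 0 s ω + S.C *ᵥ S.ctrl u s ω from
      funext (S.y_eq_add_ctrl u s)]
    exact @Measurable.add _ _ _ _ _ (_) _ _ (measurable_y_info hs) (hC _ s hs hu')
  · refine ⟨fun s hs => ?_, fun s hs => @measurable_const _ _ _ (_) _⟩
    rw [show S.y 0 s = fun ω => S.y u s ω - S.C *ᵥ S.ctrl u s ω by
      funext ω; rw [S.y_eq_add_ctrl u s]; abel]
    exact @Measurable.sub _ _ _ _ _ (_) _ _ (measurable_y_info hs)
      (hC _ s hs fun r hr => measurable_u_info hr)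

theorem F_eq_info {t : ℕ} (hu : Measurable[S.info u t] (u t)) : S.F u t = S.info u t := by
  refine le_antisymm ?_ (sup_le_sup le_rfl (iSup_mono fun s => iSup_mono' fun h => ⟨h.le, le_rfl⟩))
  refine sup_le (le_sup_of_le_left le_rfl) (iSup_le fun s => iSup_le fun hs => ?_)
  rcases hs.lt_or_eq with h | rfl
  · exact measurable_iff_comap_le.1 (measurable_u_info h)
  · exact measurable_iff_comap_le.1 hu

theorem info_zero_le_noise (S : LQSystem Ω n p m) (t : ℕ) :
    S.info 0 t ≤ ⨆ s ∈ Set.Iic t,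
      MeasurableSpace.comap (fun ω => (S.w s ω, S.v s ω)) inferInstance := by
  set 𝓖 := ⨆ s ∈ Set.Iic t,
      MeasurableSpace.comap (fun ω => (S.w s ω, S.v s ω)) inferInstance with h𝓖
  have hpair : ∀ s ≤ t, Measurable[𝓖] fun ω => (S.w s ω, S.v s ω) := fun s hs =>
    measurable_iff_comap_le.2 (le_iSup₂_of_le s hs le_rfl)
  refine info_le_iff.2 ⟨fun s hs => ?_, fun s hs => @measurable_const _ _ _ (_) _⟩
  have hx : Measurable[𝓖] (S.x 0 s) :=
    measurable_x (fun r hr => @measurable_const _ _ _ (_) _)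
      fun r hr => measurable_fst.comp (hpair r (hr.trans hs))
  exact @Measurable.add _ _ _ _ _ (_) _ _ (measurable_matrix_mulVec S.C hx)
    (measurable_snd.comp (hpair s hs))

end Separation

/-! ### Admissible inputs and the noise -/

section Control

variable {Ω : Type*} [m0 : MeasurableSpace Ω] {n p m : ℕ} {S : LQSystem Ω n p m} {Pr : Measure Ω}
  {u : ℕ → Ω → (Fin p → ℝ)}

theorem Admissible.measurable_info_zero (hu : S.Admissible Pr u) {t : ℕ} (ht : t < S.N) :
    Measurable[S.info 0 t] (u t) := by
  induction t using Nat.strong_induction_on with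
  | _ t ih =>
    have h := (hu t ht).1
    rwa [info_eq_info_zero fun s hs => ih s hs (hs.trans ht)] at h

theorem Admissible.info_eq (hu : S.Admissible Pr u) {t : ℕ} (ht : t ≤ S.N) :
    S.info u t = S.info 0 t :=
  info_eq_info_zero fun _ hs => hu.measurable_info_zero (hs.trans_le ht)

theorem Admissible.F_eq (hu : S.Admissible Pr u) {t : ℕ} (ht : t < S.N) :
    S.F u t = S.info 0 t :=
  (F_eq_info (hu t ht).1).trans (hu.info_eq ht.le)

theorem Admissible.memLp (hu : S.Admissible Pr u) {t : ℕ} (ht : t < S.N) (i : Fin p) :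
    MemLp (fun ω => u t ω i) 4 Pr :=
  (memLp_piLp_iff.1 (hu t ht).2) i

theorem admissible_of_measurable_info_zero (h : ∀ t < S.N, Measurable[S.info 0 t] (u t))
    (h4 : ∀ t < S.N, ∀ i, MemLp (fun ω => u t ω i) 4 Pr) : S.Admissible Pr u := fun t ht =>
  ⟨by rw [info_eq_info_zero fun s hs => h s (hs.trans ht)]; exact h t ht,
    memLp_piLp_iff.2 (h4 t ht)⟩

theorem admissible_zero : S.Admissible Pr 0 :=
  admissible_of_measurable_info_zero (fun _ _ => @measurable_const _ _ _ (_) _)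
    fun _ _ _ => MemLp.zero

/-- The standing assumptions on the penalty matrices and on the noises. -/
structure Standing (S : LQSystem Ω n p m) (Pr : Measure Ω) : Prop where
  hQ : S.Q.PosSemidef
  hR : S.R.PosDef
  hw : ∀ t, Measurable (S.w t)
  hv : ∀ t, Measurable (S.v t)
  hindep : iIndepFun (fun t ω => (S.w t ω, S.v t ω)) Pr
  hident : ∀ t, IdentDistrib (fun ω => (S.w t ω, S.v t ω)) (fun ω => (S.w 0 ω, S.v 0 ω)) Pr Pr
  hmom : ∀ (t q : ℕ), MemLp (fun ω => WithLp.toLp 2 (S.w t ω)) (q : ENNReal) Pr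

namespace Standing

theorem info_zero_le (hS : S.Standing Pr) (t : ℕ) : S.info 0 t ≤ m0 :=
  (info_zero_le_noise S t).trans
    (iSup₂_le fun s _ => measurable_iff_comap_le.1 ((hS.hw s).prodMk (hS.hv s)))

variable [IsProbabilityMeasure Pr]

theorem w_mem (hS : S.Standing Pr) (t : ℕ) : CoordsIn (momAlg Pr) (S.w t) := fun i q =>
  memLp_piLp_iff.1 (hS.hmom t q) i

/-- The noise `w_{t+1}` is independent of the information at time `t`. -/
theorem condVec_w (hS : S.Standing Pr) (t : ℕ) :
    condVec Pr (S.info 0 t) (S.w (t + 1)) =ᵐ[Pr] fun _ => S.wbar Pr := by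
  have hind : Indep (MeasurableSpace.comap (fun ω => (S.w (t + 1) ω, S.v (t + 1) ω)) inferInstance)
      (S.info 0 t) Pr := by
    have h := indep_iSup_of_disjoint (S := {t + 1}) (T := Set.Iic t)
      (fun s => measurable_iff_comap_le.1 ((hS.hw s).prodMk (hS.hv s))) hS.hindep (by simp)
    refine indep_of_indep_of_le_right (indep_of_indep_of_le_left h ?_) (info_zero_le_noise S t)
    exact le_iSup₂_of_le (t + 1) rfl le_rfl
  have key : ∀ i, condExp (S.info 0 t) Pr (fun ω => S.w (t + 1) ω i) =ᵐ[Pr]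
      fun _ => S.wbar Pr i := fun i => by
    have hm : Measurable fun z : (Fin n → ℝ) × (Fin m → ℝ) => z.1 i :=
      (measurable_pi_apply i).comp measurable_fst
    have hf : Measurable[MeasurableSpace.comap (fun ω => (S.w (t + 1) ω, S.v (t + 1) ω))
        inferInstance] (fun ω => S.w (t + 1) ω i) :=
      hm.comp (comap_measurable (fun ω => (S.w (t + 1) ω, S.v (t + 1) ω)))
    refine (condExp_indep_eq (measurable_iff_comap_le.1 ((hS.hw _).prodMk (hS.hv _)))
      (hS.info_zero_le t) hf.stronglyMeasurable hind).trans ?_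
    have := ((hS.hident (t + 1)).comp hm).integral_eq
    exact Filter.Eventually.of_forall fun _ => this
  filter_upwards [ae_all_iff.2 key] with ω hω
  exact funext hω

theorem x_zero_mem (hS : S.Standing Pr) (t : ℕ) : CoordsIn (momAlg Pr) (S.x 0 t) := by
  induction t with
  | zero => exact CoordsIn.const _
  | succ t ih =>
    exact ((EntriesIn.mulVec (EntriesIn.const S.A) ih).add
      (EntriesIn.mulVec (EntriesIn.const S.B) (CoordsIn.const 0))).add (hS.w_mem (t + 1))

end Standing

end Control

/-! ### Estimates and prediction errors -/

section Estimates

variable {Ω : Type*} [m0 : MeasurableSpace Ω] {n p m : ℕ} {S : LQSystem Ω n p m} {Pr : Measure Ω}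
  {u : ℕ → Ω → (Fin p → ℝ)}

theorem Standing.hQt (hS : S.Standing Pr) : S.Qᵀ = S.Q := by simpa using hS.hQ.isHermitian.eq

theorem Admissible.measurable_ctrl_succ (hu : S.Admissible Pr u) {t : ℕ} (ht : t < S.N) :
    CoordsIn (measAlg (S.info 0 t)) (S.ctrl u (t + 1)) := fun i =>
  (measurable_pi_apply i).comp (LQSystem.measurable_ctrl fun s hs =>
    (hu.measurable_info_zero (by omega)).mono (info_mono (Nat.lt_succ_iff.1 hs)) le_rfl)

theorem Admissible.measurable_ctrl (hu : S.Admissible Pr u) {t : ℕ} (ht : t ≤ S.N) :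
    CoordsIn (measAlg (S.info 0 t)) (S.ctrl u t) := fun i =>
  (measurable_pi_apply i).comp (LQSystem.measurable_ctrl fun s hs =>
    (hu.measurable_info_zero (by omega)).mono (info_mono hs.le) le_rfl)

theorem m₃_measurable (t : ℕ) : CoordsIn (measAlg (S.F u t)) (S.m₃ Pr u t) :=
  CoordsIn.smul (const_mem_alg 2) (EntriesIn.mulVec (EntriesIn.const _)
    (condVec_coordsIn_measAlg _))

theorem Qμ_measurable (μ : ℝ) (t : ℕ) : EntriesIn (measAlg (S.F u t)) (S.Qμ Pr u μ t) :=
  (EntriesIn.const _).add (EntriesIn.const_smul _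
    (((EntriesIn.const _).mul (condMat_entriesIn_measAlg _)).mul (EntriesIn.const _)))

theorem memLp_four_mulVec {k l : ℕ} (M : Matrix (Fin k) (Fin l) ℝ) {Z : Ω → Fin l → ℝ}
    (hZ : ∀ i, MemLp (fun ω => Z ω i) 4 Pr) (i : Fin k) :
    MemLp (fun ω => (M *ᵥ Z ω) i) 4 Pr :=
  memLp_finsetSum Finset.univ fun j _ => (hZ j).const_mul (M i j)

theorem Admissible.memLp_ctrl (hu : S.Admissible Pr u) {t : ℕ} (ht : t ≤ S.N) (i : Fin n) :
    MemLp (fun ω => S.ctrl u t ω i) 4 Pr := by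
  induction t generalizing i with
  | zero => exact MemLp.zero
  | succ t ih =>
    exact (memLp_four_mulVec S.A (fun i => ih (by omega) i) i).add
      (memLp_four_mulVec S.B (fun i => hu.memLp ht i) i)

variable [IsProbabilityMeasure Pr]

theorem Admissible.memLp_x (hS : S.Standing Pr) (hu : S.Admissible Pr u) {t : ℕ} (ht : t ≤ S.N)
    (i : Fin n) : MemLp (fun ω => S.x u t ω i) 4 Pr := by
  simp only [S.x_eq_add_ctrl u t]
  exact (memLp_four_of_mem_momAlg (hS.x_zero_mem t i)).add (hu.memLp_ctrl ht i)

theorem Admissible.xPred_succ (hS : S.Standing Pr) (hu : S.Admissible Pr u) {t : ℕ}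
    (ht : t < S.N) : S.xPred Pr u (t + 1) =ᵐ[Pr]
      fun ω => S.xPred Pr 0 (t + 1) ω + S.ctrl u (t + 1) ω := by
  simp only [xPred, hu.F_eq ht, (admissible_zero (Pr := Pr)).F_eq ht]
  rw [show S.x u (t + 1) = fun ω => S.x 0 (t + 1) ω + S.ctrl u (t + 1) ω from
    funext (S.x_eq_add_ctrl u (t + 1))]
  exact condVec_add_measurable (hS.info_zero_le t)
    (fun i => integrable_of_mem_momAlg (hS.x_zero_mem _ i))
    (fun i => integrable_of_memLp_four (hu.memLp_ctrl ht i)) (hu.measurable_ctrl_succ ht)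

theorem Admissible.xEst_eq (hS : S.Standing Pr) (hu : S.Admissible Pr u) {t : ℕ}
    (ht : t < S.N) : S.xEst Pr u t =ᵐ[Pr] fun ω => S.xEst Pr 0 t ω + S.ctrl u t ω := by
  simp only [xEst, hu.F_eq ht, (admissible_zero (Pr := Pr)).F_eq ht]
  rw [show S.x u t = fun ω => S.x 0 t ω + S.ctrl u t ω from funext (S.x_eq_add_ctrl u t)]
  exact condVec_add_measurable (hS.info_zero_le t)
    (fun i => integrable_of_mem_momAlg (hS.x_zero_mem _ i))
    (fun i => integrable_of_memLp_four (hu.memLp_ctrl ht.le i)) (hu.measurable_ctrl ht.le)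

theorem Admissible.memLp_xEst (hS : S.Standing Pr) (hu : S.Admissible Pr u) {t : ℕ}
    (ht : t < S.N) (i : Fin n) : MemLp (fun ω => S.xEst Pr u t ω i) 4 Pr :=
  (hu.memLp_x hS ht.le i).condExp (by norm_num)

theorem Admissible.memLp_xPred (hS : S.Standing Pr) (hu : S.Admissible Pr u) {t : ℕ}
    (ht : t < S.N) (i : Fin n) : MemLp (fun ω => S.xPred Pr u (t + 1) ω i) 4 Pr :=
  (hu.memLp_x hS ht i).condExp (by norm_num)

theorem Admissible.δ_eq (hS : S.Standing Pr) (hu : S.Admissible Pr u) {t : ℕ} (ht : t < S.N) :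
    S.δ Pr u (t + 1) =ᵐ[Pr] S.δ Pr 0 (t + 1) := by
  filter_upwards [hu.xPred_succ hS ht] with ω hω
  simp only [δ, hω, S.x_eq_add_ctrl u (t + 1)]
  abel

/-- The estimation error does not depend on the input. -/
theorem Admissible.x_sub_xEst_eq (hS : S.Standing Pr) (hu : S.Admissible Pr u) {t : ℕ}
    (ht : t < S.N) : (fun ω => S.x u t ω - S.xEst Pr u t ω) =ᵐ[Pr]
      fun ω => S.x 0 t ω - S.xEst Pr 0 t ω := by
  filter_upwards [hu.xEst_eq hS ht] with ω hω
  simp only [hω, S.x_eq_add_ctrl u t]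
  abel

theorem Admissible.e_eq (hS : S.Standing Pr) (hu : S.Admissible Pr u) {t : ℕ}
    (ht : t + 1 < S.N) : S.e Pr u (t + 1) =ᵐ[Pr] S.e Pr 0 (t + 1) := by
  filter_upwards [hu.xPred_succ hS (by omega : t < S.N), hu.xEst_eq hS ht] with ω h1 h2
  simp only [e, h1, h2]
  abel

theorem Standing.x_sub_xEst_zero_mem (hS : S.Standing Pr) (t : ℕ) :
    CoordsIn (momAlg Pr) fun ω => S.x 0 t ω - S.xEst Pr 0 t ω :=
  (hS.x_zero_mem t).sub (condVec_coordsIn_momAlg (hS.x_zero_mem t))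

theorem Admissible.δ_mem (hS : S.Standing Pr) (hu : S.Admissible Pr u) {t : ℕ} (ht : t < S.N) :
    CoordsIn (momAlg Pr) (S.δ Pr u (t + 1)) := by
  have h0 : CoordsIn (momAlg Pr) (S.δ Pr 0 (t + 1)) :=
    (hS.x_zero_mem _).sub (condVec_coordsIn_momAlg (hS.x_zero_mem _))
  exact fun i => momAlg_congr (h0 i) ((hu.δ_eq hS ht).symm.mono fun ω hω => congrFun hω i)

theorem Admissible.e_mem (hS : S.Standing Pr) (hu : S.Admissible Pr u) {t : ℕ}
    (ht : t + 1 < S.N) : CoordsIn (momAlg Pr) (S.e Pr u (t + 1)) := by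
  have h0 : CoordsIn (momAlg Pr) (S.e Pr 0 (t + 1)) :=
    (condVec_coordsIn_momAlg (hS.x_zero_mem _)).sub (condVec_coordsIn_momAlg (hS.x_zero_mem _))
  exact fun i => momAlg_congr (h0 i) ((hu.e_eq hS ht).symm.mono fun ω hω => congrFun hω i)

theorem Admissible.W_eq (hS : S.Standing Pr) (hu : S.Admissible Pr u) {t : ℕ} (ht : t < S.N) :
    S.W Pr u t =ᵐ[Pr] S.W Pr 0 t := by
  simp only [W, hu.F_eq ht, (admissible_zero (Pr := Pr)).F_eq ht]
  exact condMat_congr_ae ((hu.δ_eq hS ht).mono fun ω hω => by simp only [hω])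

theorem Admissible.m₃_eq (hS : S.Standing Pr) (hu : S.Admissible Pr u) {t : ℕ} (ht : t < S.N) :
    S.m₃ Pr u t =ᵐ[Pr] S.m₃ Pr 0 t := by
  unfold m₃
  rw [hu.F_eq ht, (admissible_zero (Pr := Pr)).F_eq ht]
  have := condVec_congr_ae (Pr := Pr) (m := S.info 0 t) ((hu.δ_eq hS ht).mono fun ω hω =>
    show (fun ω' => (S.δ Pr u (t + 1) ω' ⬝ᵥ S.Q *ᵥ S.δ Pr u (t + 1) ω') • S.δ Pr u (t + 1) ω') ω
      = (fun ω' => (S.δ Pr 0 (t + 1) ω' ⬝ᵥ S.Q *ᵥ S.δ Pr 0 (t + 1) ω') • S.δ Pr 0 (t + 1) ω') ω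
      by simp only [hω])
  filter_upwards [this] with ω hω
  rw [hω]

theorem Admissible.W_mem (hS : S.Standing Pr) (hu : S.Admissible Pr u) {t : ℕ} (ht : t < S.N) :
    EntriesIn (momAlg Pr) (S.W Pr u t) :=
  condMat_entriesIn_momAlg ((hu.δ_mem hS ht).vecMulVec (hu.δ_mem hS ht))

theorem Admissible.δQδ_mem (hS : S.Standing Pr) (hu : S.Admissible Pr u) {t : ℕ} (ht : t < S.N) :
    (fun ω => S.δ Pr u (t + 1) ω ⬝ᵥ S.Q *ᵥ S.δ Pr u (t + 1) ω) ∈ momAlg Pr :=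
  quadForm_mem_alg (hu.δ_mem hS ht) (EntriesIn.const _)

theorem Admissible.m₃_mem (hS : S.Standing Pr) (hu : S.Admissible Pr u) {t : ℕ} (ht : t < S.N) :
    CoordsIn (momAlg Pr) (S.m₃ Pr u t) :=
  CoordsIn.smul (const_mem_alg 2) (EntriesIn.mulVec (EntriesIn.const _)
    (condVec_coordsIn_momAlg (CoordsIn.smul (hu.δQδ_mem hS ht) (hu.δ_mem hS ht))))

theorem Admissible.W_posSemidef (hS : S.Standing Pr) (hu : S.Admissible Pr u) {t : ℕ}
    (ht : t < S.N) : ∀ᵐ ω ∂Pr, (S.W Pr u t ω).PosSemidef := by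
  refine condMat_posSemidef (fun i j => integrable_of_mem_momAlg
    ((hu.δ_mem hS ht).vecMulVec (hu.δ_mem hS ht) i j)) (Filter.Eventually.of_forall fun ω => ?_)
  simpa using Matrix.posSemidef_vecMulVec_self_star (S.δ Pr u (t + 1) ω)

theorem Admissible.Qμ_posSemidef (hS : S.Standing Pr) (hu : S.Admissible Pr u) {μ : ℝ}
    (hμ : 0 ≤ μ) {t : ℕ} (ht : t < S.N) : ∀ᵐ ω ∂Pr, (S.Qμ Pr u μ t ω).PosSemidef := by
  filter_upwards [hu.W_posSemidef hS ht] with ω hω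
  refine hS.hQ.add (Matrix.PosSemidef.smul ?_ (by positivity))
  have := hω.conjTranspose_mul_mul_same S.Q
  rwa [hS.hQ.isHermitian.eq] at this

theorem Admissible.Qμ_mem (hS : S.Standing Pr) (hu : S.Admissible Pr u) (μ : ℝ) {t : ℕ}
    (ht : t < S.N) : EntriesIn (momAlg Pr) (S.Qμ Pr u μ t) :=
  (EntriesIn.const _).add (EntriesIn.const_smul _
    (((EntriesIn.const _).mul (hu.W_mem hS ht)).mul (EntriesIn.const _)))

theorem Admissible.Qμ_eq (hS : S.Standing Pr) (hu : S.Admissible Pr u) (μ : ℝ) {t : ℕ}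
    (ht : t < S.N) : S.Qμ Pr u μ t =ᵐ[Pr] S.Qμ Pr 0 μ t := by
  filter_upwards [hu.W_eq hS ht] with ω hω
  simp only [Qμ, hω]

/-- The prediction is `A x̂_{t|t} + B u_t + w̄`. -/
theorem Admissible.xPred_succ_eq (hS : S.Standing Pr) (hu : S.Admissible Pr u) {t : ℕ}
    (ht : t < S.N) : S.xPred Pr u (t + 1) =ᵐ[Pr]
      fun ω => S.A *ᵥ S.xEst Pr u t ω + S.B *ᵥ u t ω + S.wbar Pr := by
  simp only [xPred, xEst, hu.F_eq ht]
  have hx : ∀ i, Integrable (fun ω => S.x u t ω i) Pr := fun i =>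
    integrable_of_memLp_four (hu.memLp_x hS ht.le i)
  have hAx : ∀ i, Integrable (fun ω => (S.A *ᵥ S.x u t ω) i) Pr := fun i =>
    integrable_of_memLp_four (memLp_four_mulVec S.A (hu.memLp_x hS ht.le) i)
  have hBu : ∀ i, Integrable (fun ω => (S.B *ᵥ u t ω) i) Pr := fun i =>
    integrable_of_memLp_four (memLp_four_mulVec S.B (fun i => hu.memLp ht i) i)
  have hw : ∀ i, Integrable (fun ω => S.w (t + 1) ω i) Pr := fun i =>
    integrable_of_mem_momAlg (hS.w_mem _ i)
  have hBum : CoordsIn (measAlg (S.info 0 t)) fun ω => S.B *ᵥ u t ω := fun i =>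
    (measurable_pi_apply i).comp (measurable_matrix_mulVec S.B (hu.measurable_info_zero ht))
  have h1 := condVec_add (m := S.info 0 t) (Z := fun ω => S.A *ᵥ S.x u t ω + S.B *ᵥ u t ω)
    (fun i => (hAx i).add (hBu i)) hw
  filter_upwards [h1, condVec_add_measurable (hS.info_zero_le t) hAx hBu hBum, hS.condVec_w t,
    condVec_mulVec (m := S.info 0 t) S.A hx] with ω e1 e2 e3 e4
  rw [← e4, ← e2, ← e3]
  exact e1

end Estimates

/-! ### The backward recursion -/

section Recursion

variable {Ω : Type*} [m0 : MeasurableSpace Ω] {n p m : ℕ} {S : LQSystem Ω n p m} {Pr : Measure Ω}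
  {u : ℕ → Ω → (Fin p → ℝ)} {μ : ℝ} {t : ℕ} {q : QuadCoeff Ω n}

theorem coeff_of_lt (ht : t < S.N) :
    S.coeff Pr u μ t = S.step Pr u μ t (S.coeff Pr u μ (t + 1)) := by
  rw [coeff, if_pos ht]

theorem coeff_of_le (ht : S.N ≤ t) : S.coeff Pr u μ t = ⟨fun _ => 0, fun _ => 0, fun _ => 0⟩ := by
  rw [coeff, if_neg (by omega)]

theorem stepV_measurable : EntriesIn (measAlg (S.F u t)) (S.stepV Pr u μ t q) :=
  (condMat_entriesIn_measAlg _).add (Qμ_measurable μ t)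

theorem stepξ_measurable : CoordsIn (measAlg (S.F u t)) (S.stepξ Pr u μ t q) :=
  (condVec_coordsIn_measAlg _).add (CoordsIn.smul (const_mem_alg μ) (m₃_measurable t))

/-- If `V_t`, `ξ_t`, `d_t` and `(B' V_t B + R)⁻¹` have entries in an algebra of random variables,
then so have the feedback coefficients. -/
theorem gains_mem {𝓐 : Subalgebra ℝ (Ω → ℝ)} (hV : EntriesIn 𝓐 (S.stepV Pr u μ t q))
    (hξ : CoordsIn 𝓐 (S.stepξ Pr u μ t q))
    (hH : EntriesIn 𝓐 fun ω => (S.stepH Pr u μ t q ω)⁻¹) :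
    EntriesIn 𝓐 (S.stepK Pr u μ t q) ∧ CoordsIn 𝓐 (S.stepl Pr u μ t q) :=
  ⟨(((hH.mul (EntriesIn.const _)).mul hV).mul (EntriesIn.const _)).neg,
    ((hH.mul (EntriesIn.const _)).mulVec (hξ.add (hV.mulVec (CoordsIn.const _)))).neg⟩

theorem step_mem {𝓐 : Subalgebra ℝ (Ω → ℝ)} (hV : EntriesIn 𝓐 (S.stepV Pr u μ t q))
    (hξ : CoordsIn 𝓐 (S.stepξ Pr u μ t q)) (hd : S.stepd Pr u t q ∈ 𝓐)
    (hH : EntriesIn 𝓐 fun ω => (S.stepH Pr u μ t q ω)⁻¹) :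
    EntriesIn 𝓐 (S.step Pr u μ t q).P ∧ CoordsIn 𝓐 (S.step Pr u μ t q).ζ ∧
      (S.step Pr u μ t q).c ∈ 𝓐 := by
  obtain ⟨hK, hl⟩ := gains_mem hV hξ hH
  have hA : EntriesIn 𝓐 fun ω => S.A + S.B * S.stepK Pr u μ t q ω :=
    (EntriesIn.const _).add ((EntriesIn.const _).mul hK)
  have hH' : EntriesIn 𝓐 (S.stepH Pr u μ t q) :=
    (((EntriesIn.const _).mul hV).mul (EntriesIn.const _)).add (EntriesIn.const _)
  refine ⟨((hA.transpose.mul hV).mul hA).add ((hK.transpose.mul (EntriesIn.const _)).mul hK),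
    hA.transpose.mulVec (hξ.add (hV.mulVec (CoordsIn.const _))), ?_⟩
  refine 𝓐.add_mem (𝓐.sub_mem (𝓐.add_mem hd (quadForm_mem_alg (CoordsIn.const _) hV))
    (quadForm_mem_alg hl hH')) (𝓐.mul_mem (const_mem_alg 2)
      (dotProduct_mem_alg hξ (CoordsIn.const _)))

theorem stepHinv_measurable :
    EntriesIn (measAlg (S.F u t)) fun ω => (S.stepH Pr u μ t q ω)⁻¹ :=
  inv_entriesIn_measAlg ((((EntriesIn.const _).mul stepV_measurable).mul (EntriesIn.const _)).add
    (EntriesIn.const _))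

theorem step_measurable : EntriesIn (measAlg (S.F u t)) (S.step Pr u μ t q).P ∧
    CoordsIn (measAlg (S.F u t)) (S.step Pr u μ t q).ζ ∧
      (S.step Pr u μ t q).c ∈ measAlg (S.F u t) :=
  step_mem stepV_measurable stepξ_measurable (condExp_mem_measAlg _) stepHinv_measurable

theorem K_measurable : EntriesIn (measAlg (S.F u t)) (S.K Pr u μ t) :=
  (gains_mem stepV_measurable stepξ_measurable stepHinv_measurable).1

theorem l_measurable : CoordsIn (measAlg (S.F u t)) (S.l Pr u μ t) :=
  (gains_mem stepV_measurable stepξ_measurable stepHinv_measurable).2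

theorem coeff_measurable (ht : t < S.N) : EntriesIn (measAlg (S.F u t)) (S.coeff Pr u μ t).P ∧
    CoordsIn (measAlg (S.F u t)) (S.coeff Pr u μ t).ζ ∧
      (S.coeff Pr u μ t).c ∈ measAlg (S.F u t) := by
  rw [coeff_of_lt ht]
  exact step_measurable

theorem Standing.stepH_posDef (hS : S.Standing Pr) {ω : Ω}
    (hV : (S.stepV Pr u μ t q ω).PosSemidef) : (S.stepH Pr u μ t q ω).PosDef :=
  Matrix.PosDef.posSemidef_add (hV.transpose_mul_mul_same S.B) hS.hR

theorem Standing.step_P_posSemidef (hS : S.Standing Pr) {ω : Ω}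
    (hV : (S.stepV Pr u μ t q ω).PosSemidef) : ((S.step Pr u μ t q).P ω).PosSemidef :=
  (hV.transpose_mul_mul_same _).add (hS.hR.posSemidef.transpose_mul_mul_same _)

theorem Admissible.F_le (hS : S.Standing Pr) (hu : S.Admissible Pr u) (ht : t < S.N) :
    S.F u t ≤ m0 := by
  rw [hu.F_eq ht]
  exact hS.info_zero_le t

variable [IsProbabilityMeasure Pr]

theorem Admissible.stepV_posSemidef (hS : S.Standing Pr) (hu : S.Admissible Pr u) (hμ : 0 ≤ μ)
    (ht : t < S.N) (hP : EntriesIn (momAlg Pr) q.P) (hpos : ∀ᵐ ω ∂Pr, (q.P ω).PosSemidef) :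
    ∀ᵐ ω ∂Pr, (S.stepV Pr u μ t q ω).PosSemidef := by
  filter_upwards [condMat_posSemidef (m := S.F u t)
    (fun i j => integrable_of_mem_momAlg (hP i j)) hpos, hu.Qμ_posSemidef hS hμ ht] with ω h1 h2
  exact h1.add h2

theorem Admissible.stepV_mem (hS : S.Standing Pr) (hu : S.Admissible Pr u)
    (ht : t < S.N) (hP : EntriesIn (momAlg Pr) q.P) :
    EntriesIn (momAlg Pr) (S.stepV Pr u μ t q) :=
  (condMat_entriesIn_momAlg hP).add (hu.Qμ_mem hS μ ht)

theorem Admissible.stepξ_mem (hS : S.Standing Pr) (hu : S.Admissible Pr u)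
    (ht : t < S.N) (hξ : CoordsIn (momAlg Pr) (S.ξArg Pr u t q)) :
    CoordsIn (momAlg Pr) (S.stepξ Pr u μ t q) :=
  (condVec_coordsIn_momAlg hξ).add (CoordsIn.smul (const_mem_alg μ) (hu.m₃_mem hS ht))

/-- The inverse of `B' V_t B + R` has bounded entries, because `B' V_t B ⪰ 0`. -/
theorem Admissible.stepHinv_mem (hS : S.Standing Pr) (hu : S.Admissible Pr u) (hμ : 0 ≤ μ)
    (ht : t < S.N) (hP : EntriesIn (momAlg Pr) q.P) (hpos : ∀ᵐ ω ∂Pr, (q.P ω).PosSemidef) :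
    EntriesIn (momAlg Pr) fun ω => (S.stepH Pr u μ t q ω)⁻¹ :=
  inv_add_entriesIn_momAlg (hu.F_le hS ht) hS.hR
    (((EntriesIn.const _).mul stepV_measurable).mul (EntriesIn.const _))
    ((hu.stepV_posSemidef hS hμ ht hP hpos).mono fun _ hω => hω.transpose_mul_mul_same S.B)

theorem Admissible.args_mem (hS : S.Standing Pr) (hu : S.Admissible Pr u) (ht : t < S.N)
    (hP : EntriesIn (momAlg Pr) (S.coeff Pr u μ (t + 1)).P)
    (hζ : CoordsIn (momAlg Pr) (S.coeff Pr u μ (t + 1)).ζ)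
    (hc : (S.coeff Pr u μ (t + 1)).c ∈ momAlg Pr) :
    CoordsIn (momAlg Pr) (fun ω => (S.coeff Pr u μ (t + 1)).P ω *ᵥ S.e Pr u (t + 1) ω) ∧
    CoordsIn (momAlg Pr) (S.ξArg Pr u t (S.coeff Pr u μ (t + 1))) ∧
      S.dArg Pr u t (S.coeff Pr u μ (t + 1)) ∈ momAlg Pr := by
  rcases (show t + 1 ≤ S.N from ht).lt_or_eq with h | h
  · have he := hu.e_mem hS h
    exact ⟨hP.mulVec he, (hP.mulVec he).add hζ, (momAlg Pr).add_mem
      ((momAlg Pr).add_mem hc (quadForm_mem_alg he hP))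
      ((momAlg Pr).mul_mem (const_mem_alg 2) (dotProduct_mem_alg he hζ))⟩
  · -- At the horizon the coefficients vanish, so nothing is required of `e_N`.
    unfold ξArg dArg
    simp only [coeff_of_le h.ge, Matrix.zero_mulVec, add_zero, dotProduct_zero, mul_zero]
    exact ⟨CoordsIn.const 0, CoordsIn.const 0, const_mem_alg 0⟩

/-- The coefficients of the recursion have moments of every order, and `P_t ⪰ 0`. -/
theorem Admissible.coeff_mem (hS : S.Standing Pr) (hu : S.Admissible Pr u) (hμ : 0 ≤ μ) (t : ℕ) :
    EntriesIn (momAlg Pr) (S.coeff Pr u μ t).P ∧ CoordsIn (momAlg Pr) (S.coeff Pr u μ t).ζ ∧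
      (S.coeff Pr u μ t).c ∈ momAlg Pr ∧ ∀ᵐ ω ∂Pr, ((S.coeff Pr u μ t).P ω).PosSemidef := by
  obtain ht | ht := le_or_gt S.N t
  · rw [coeff_of_le ht]
    exact ⟨EntriesIn.const 0, CoordsIn.const 0, const_mem_alg 0,
      Filter.Eventually.of_forall fun _ => Matrix.PosSemidef.zero⟩
  · obtain ⟨hP, hζ, hc, hpos⟩ := Admissible.coeff_mem hS hu hμ (t + 1)
    obtain ⟨-, hξ, hd⟩ := hu.args_mem hS ht hP hζ hc
    rw [coeff_of_lt ht]
    obtain ⟨h1, h2, h3⟩ := step_mem (𝓐 := momAlg Pr) (hu.stepV_mem hS (μ := μ) ht hP)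
      (hu.stepξ_mem hS ht hξ) (condExp_mem_momAlg hd) (hu.stepHinv_mem hS hμ ht hP hpos)
    exact ⟨h1, h2, h3, (hu.stepV_posSemidef hS hμ ht hP hpos).mono fun ω hω =>
      hS.step_P_posSemidef hω⟩
termination_by S.N - t

theorem Admissible.coeff_args_mem (hS : S.Standing Pr) (hu : S.Admissible Pr u) (hμ : 0 ≤ μ)
    (ht : t < S.N) :
    CoordsIn (momAlg Pr) (fun ω => (S.coeff Pr u μ (t + 1)).P ω *ᵥ S.e Pr u (t + 1) ω) ∧
    CoordsIn (momAlg Pr) (S.ξArg Pr u t (S.coeff Pr u μ (t + 1))) ∧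
      S.dArg Pr u t (S.coeff Pr u μ (t + 1)) ∈ momAlg Pr := by
  obtain ⟨hP, hζ, hc, -⟩ := hu.coeff_mem hS hμ (t + 1)
  exact hu.args_mem hS ht hP hζ hc

theorem Admissible.V_posSemidef (hS : S.Standing Pr) (hu : S.Admissible Pr u) (hμ : 0 ≤ μ)
    (ht : t < S.N) :
    ∀ᵐ ω ∂Pr, (S.stepV Pr u μ t (S.coeff Pr u μ (t + 1)) ω).PosSemidef := by
  obtain ⟨hP, -, -, hpos⟩ := hu.coeff_mem hS hμ (t + 1)
  exact hu.stepV_posSemidef hS hμ ht hP hpos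

theorem Admissible.gains_mem (hS : S.Standing Pr) (hu : S.Admissible Pr u) (hμ : 0 ≤ μ)
    (ht : t < S.N) :
    EntriesIn (momAlg Pr) (S.K Pr u μ t) ∧ CoordsIn (momAlg Pr) (S.l Pr u μ t) := by
  obtain ⟨hP, -, -, hpos⟩ := hu.coeff_mem hS hμ (t + 1)
  exact LQSystem.gains_mem (hu.stepV_mem hS ht hP)
    (hu.stepξ_mem hS ht (hu.coeff_args_mem hS hμ ht).2.1) (hu.stepHinv_mem hS hμ ht hP hpos)

/-- One step of the recursion does not depend on the input if its data do not. -/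
theorem Admissible.step_congr (hS : S.Standing Pr) (hu : S.Admissible Pr u) (ht : t < S.N)
    (hq : ∀ᵐ ω ∂Pr, (S.coeff Pr u μ (t + 1)).P ω = (S.coeff Pr 0 μ (t + 1)).P ω ∧
      (S.coeff Pr u μ (t + 1)).ζ ω = (S.coeff Pr 0 μ (t + 1)).ζ ω ∧
      (S.coeff Pr u μ (t + 1)).c ω = (S.coeff Pr 0 μ (t + 1)).c ω) :
    ∀ᵐ ω ∂Pr,
      S.stepV Pr u μ t (S.coeff Pr u μ (t + 1)) ω = S.stepV Pr 0 μ t (S.coeff Pr 0 μ (t + 1)) ω ∧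
      S.stepξ Pr u μ t (S.coeff Pr u μ (t + 1)) ω = S.stepξ Pr 0 μ t (S.coeff Pr 0 μ (t + 1)) ω ∧
      S.stepd Pr u t (S.coeff Pr u μ (t + 1)) ω = S.stepd Pr 0 t (S.coeff Pr 0 μ (t + 1)) ω := by
  have hargs : ∀ᵐ ω ∂Pr,
      S.ξArg Pr u t (S.coeff Pr u μ (t + 1)) ω = S.ξArg Pr 0 t (S.coeff Pr 0 μ (t + 1)) ω ∧
      S.dArg Pr u t (S.coeff Pr u μ (t + 1)) ω = S.dArg Pr 0 t (S.coeff Pr 0 μ (t + 1)) ω := by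
    rcases (show t + 1 ≤ S.N from ht).lt_or_eq with h | h
    · filter_upwards [hq, hu.e_eq hS h] with ω ⟨h1, h2, h3⟩ h4
      simp only [ξArg, dArg, h1, h2, h3, h4, and_self]
    · refine Filter.Eventually.of_forall fun ω => ?_
      simp [ξArg, dArg, coeff_of_le h.ge]
  have hF : S.F u t = S.F 0 t := (hu.F_eq ht).trans ((admissible_zero (Pr := Pr)).F_eq ht).symm
  have hP : condMat Pr (S.F u t) (S.coeff Pr u μ (t + 1)).P =ᵐ[Pr]
      condMat Pr (S.F 0 t) (S.coeff Pr 0 μ (t + 1)).P := by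
    rw [hF]; exact condMat_congr_ae (hq.mono fun ω h => h.1)
  have hξ : condVec Pr (S.F u t) (S.ξArg Pr u t (S.coeff Pr u μ (t + 1))) =ᵐ[Pr]
      condVec Pr (S.F 0 t) (S.ξArg Pr 0 t (S.coeff Pr 0 μ (t + 1))) := by
    rw [hF]; exact condVec_congr_ae (hargs.mono fun ω h => h.1)
  have hd : S.stepd Pr u t (S.coeff Pr u μ (t + 1)) =ᵐ[Pr]
      S.stepd Pr 0 t (S.coeff Pr 0 μ (t + 1)) := by
    unfold stepd
    rw [hF]; exact condExp_congr_ae (hargs.mono fun ω h => h.2)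
  filter_upwards [hP, hξ, hd, hu.Qμ_eq hS μ ht, hu.m₃_eq hS ht] with ω h1 h2 h3 h4 h5
  exact ⟨by simp only [stepV, h1, h4], by simp only [stepξ, h2, h5], h3⟩

/-- The coefficients of the recursion do not depend on the input. -/
theorem Admissible.coeff_eq (hS : S.Standing Pr) (hu : S.Admissible Pr u) (μ : ℝ) (t : ℕ) :
    ∀ᵐ ω ∂Pr, (S.coeff Pr u μ t).P ω = (S.coeff Pr 0 μ t).P ω ∧
      (S.coeff Pr u μ t).ζ ω = (S.coeff Pr 0 μ t).ζ ω ∧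
      (S.coeff Pr u μ t).c ω = (S.coeff Pr 0 μ t).c ω := by
  obtain ht | ht := le_or_gt S.N t
  · simp [coeff_of_le ht]
  · filter_upwards [hu.step_congr hS ht (Admissible.coeff_eq hS hu μ (t + 1))] with ω ⟨h1, h2, h3⟩
    simp only [coeff_of_lt ht, step, stepK, stepl, stepH, h1, h2, h3, and_self]
termination_by S.N - t

theorem Admissible.gains_eq (hS : S.Standing Pr) (hu : S.Admissible Pr u) (μ : ℝ) (ht : t < S.N) :
    ∀ᵐ ω ∂Pr, S.K Pr u μ t ω = S.K Pr 0 μ t ω ∧ S.l Pr u μ t ω = S.l Pr 0 μ t ω := by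
  filter_upwards [hu.step_congr hS ht (hu.coeff_eq hS μ (t + 1))] with ω ⟨h1, h2, h3⟩
  simp only [K, l, stepK, stepl, stepH, h1, h2, and_self]

end Recursion

/-! ### Completion of squares -/

section Squares

/-- Completion of squares for one stage: with gains `K`, `l` that satisfy the normal equations
`H K = -B' V A` and `H l = -B' (ξ + V w̄)`, the stage value at the successor estimate
`A x + B u + w̄` is a quadratic function of `x` plus the square of `u - (K x + l)` weighted
by `H = B' V B + R`. -/
theorem completion_of_squares {n p : ℕ} {A V : Matrix (Fin n) (Fin n) ℝ}
    {B : Matrix (Fin n) (Fin p) ℝ} {R H : Matrix (Fin p) (Fin p) ℝ} {K : Matrix (Fin p) (Fin n) ℝ}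
    {l : Fin p → ℝ} {ξ wb : Fin n → ℝ} (hV : Vᵀ = V) (hR : Rᵀ = R) (hH : H = Bᵀ * V * B + R)
    (hK : H * K = -(Bᵀ * V * A)) (hl : H *ᵥ l = -(Bᵀ *ᵥ (ξ + V *ᵥ wb)))
    (x : Fin n → ℝ) (u : Fin p → ℝ) (d : ℝ) :
    (A *ᵥ x + B *ᵥ u + wb) ⬝ᵥ V *ᵥ (A *ᵥ x + B *ᵥ u + wb) +
        2 * ((A *ᵥ x + B *ᵥ u + wb) ⬝ᵥ ξ) + d + u ⬝ᵥ R *ᵥ u =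
      (x ⬝ᵥ ((A + B * K)ᵀ * V * (A + B * K) + Kᵀ * R * K) *ᵥ x +
        2 * (((A + B * K)ᵀ *ᵥ (ξ + V *ᵥ wb)) ⬝ᵥ x) +
        (d + wb ⬝ᵥ V *ᵥ wb - l ⬝ᵥ H *ᵥ l + 2 * (ξ ⬝ᵥ wb))) +
      (u - (K *ᵥ x + l)) ⬝ᵥ H *ᵥ (u - (K *ᵥ x + l)) := by
  -- All terms are expressed through the vectors `f = A x`, `κ = K x` and the normal equations.
  have adj : ∀ {k r : ℕ} (M : Matrix (Fin k) (Fin r) ℝ) (a : Fin r → ℝ) (b : Fin k → ℝ),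
      (Mᵀ *ᵥ b) ⬝ᵥ a = b ⬝ᵥ M *ᵥ a := fun M a b => by
    rw [Matrix.mulVec_transpose, Matrix.dotProduct_mulVec]
  have symm : ∀ {k : ℕ} {M : Matrix (Fin k) (Fin k) ℝ} (_ : Mᵀ = M) (a b : Fin k → ℝ),
      a ⬝ᵥ M *ᵥ b = b ⬝ᵥ M *ᵥ a := fun {k} {M} h a b => by
    rw [← adj, h, dotProduct_comm]
  have hHt : Hᵀ = H := by
    rw [hH]; simp [Matrix.transpose_mul, hV, hR, Matrix.mul_assoc]
  have hHK : ∀ a : Fin p → ℝ, a ⬝ᵥ H *ᵥ (K *ᵥ x) = -((B *ᵥ a) ⬝ᵥ V *ᵥ (A *ᵥ x)) := fun a => by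
    rw [Matrix.mulVec_mulVec, hK, Matrix.neg_mulVec, dotProduct_neg, ← Matrix.mulVec_mulVec,
      ← Matrix.mulVec_mulVec, dotProduct_comm, adj, dotProduct_comm]
  have hHl : ∀ a : Fin p → ℝ, a ⬝ᵥ H *ᵥ l = -((B *ᵥ a) ⬝ᵥ (ξ + V *ᵥ wb)) := fun a => by
    rw [hl, dotProduct_neg, dotProduct_comm, adj, dotProduct_comm]
  have hHe : ∀ a b : Fin p → ℝ, a ⬝ᵥ H *ᵥ b = (B *ᵥ a) ⬝ᵥ V *ᵥ (B *ᵥ b) + a ⬝ᵥ R *ᵥ b :=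
    fun a b => by
      rw [hH, Matrix.add_mulVec, dotProduct_add, ← Matrix.mulVec_mulVec, ← Matrix.mulVec_mulVec,
        dotProduct_comm a, adj, dotProduct_comm]
  have hP : x ⬝ᵥ ((A + B * K)ᵀ * V * (A + B * K) + Kᵀ * R * K) *ᵥ x =
      (A *ᵥ x + B *ᵥ (K *ᵥ x)) ⬝ᵥ V *ᵥ (A *ᵥ x + B *ᵥ (K *ᵥ x)) +
        (K *ᵥ x) ⬝ᵥ R *ᵥ (K *ᵥ x) := by
    rw [Matrix.add_mulVec, dotProduct_add, ← Matrix.mulVec_mulVec, ← Matrix.mulVec_mulVec,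
      ← Matrix.mulVec_mulVec, ← Matrix.mulVec_mulVec, dotProduct_comm x, adj, dotProduct_comm x,
      adj, Matrix.add_mulVec, ← Matrix.mulVec_mulVec, dotProduct_comm, dotProduct_comm (_ *ᵥ _)]
  rw [hP, adj, Matrix.add_mulVec, ← Matrix.mulVec_mulVec]
  set f := A *ᵥ x
  set κ := K *ᵥ x
  have h1 := hHK u
  have h2 := hHK κ
  have h3 := hHK l
  have h4 := hHl u
  have h5 := hHl κ
  have h6 := hHl l
  have h7 := hHe u u
  have h8 := hHe κ κ
  have s1 := symm hHt κ u
  have s2 := symm hHt l u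
  have s3 := symm hHt κ l
  have s4 := symm hV wb f
  have s5 := symm hV f (B *ᵥ u)
  have s6 := symm hV f (B *ᵥ κ)
  have s7 := symm hV wb (B *ᵥ u)
  have c1 := dotProduct_comm ξ f
  have c2 := dotProduct_comm ξ (B *ᵥ κ)
  have c3 := dotProduct_comm ξ wb
  have c4 := dotProduct_comm (V *ᵥ wb) f
  have c5 := dotProduct_comm (V *ᵥ wb) (B *ᵥ κ)
  simp only [Matrix.mulVec_add, Matrix.mulVec_sub, dotProduct_add, add_dotProduct, dotProduct_sub,
    sub_dotProduct] at *
  linarith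

end Squares

/-! ### The value of an input -/

section Value

variable {Ω : Type*} [m0 : MeasurableSpace Ω] {n p m : ℕ}

/-- The loss `(u_t - (K_t x̂_{t|t} + l_t))' (B' V_t B + R) (u_t - (K_t x̂_{t|t} + l_t))` that the
input causes at stage `t` by deviating from the feedback law. -/
def loss (S : LQSystem Ω n p m) (Pr : Measure Ω) (u : ℕ → Ω → (Fin p → ℝ)) (μ : ℝ) (t : ℕ) :
    Ω → ℝ := fun ω =>
  (u t ω - (S.K Pr u μ t ω *ᵥ S.xEst Pr u t ω + S.l Pr u μ t ω)) ⬝ᵥ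
    S.stepH Pr u μ t (S.coeff Pr u μ (t + 1)) ω *ᵥ
      (u t ω - (S.K Pr u μ t ω *ᵥ S.xEst Pr u t ω + S.l Pr u μ t ω))

variable {S : LQSystem Ω n p m} {Pr : Measure Ω} {u : ℕ → Ω → (Fin p → ℝ)} {μ : ℝ} {t : ℕ}

theorem quadValue_of_le (ht : S.N ≤ t) : S.quadValue Pr u μ t = 0 := by
  funext ω
  simp [quadValue, coeff_of_le ht]

/-- The value at stage `t + 1`, expanded around the prediction `x̂_{t+1}`. -/
theorem quadValue_succ_eq {ω : Ω} (hP : ((S.coeff Pr u μ (t + 1)).P ω)ᵀ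
      = (S.coeff Pr u μ (t + 1)).P ω) :
    S.quadValue Pr u μ (t + 1) ω =
      S.xPred Pr u (t + 1) ω ⬝ᵥ (S.coeff Pr u μ (t + 1)).P ω *ᵥ S.xPred Pr u (t + 1) ω +
      2 * (S.xPred Pr u (t + 1) ω ⬝ᵥ S.ξArg Pr u t (S.coeff Pr u μ (t + 1)) ω) +
      S.dArg Pr u t (S.coeff Pr u μ (t + 1)) ω := by
  have hx : S.xEst Pr u (t + 1) ω = S.xPred Pr u (t + 1) ω + S.e Pr u (t + 1) ω := by
    simp only [e]; abel
  have hsymm : S.e Pr u (t + 1) ω ⬝ᵥ (S.coeff Pr u μ (t + 1)).P ω *ᵥ S.xPred Pr u (t + 1) ω =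
      S.xPred Pr u (t + 1) ω ⬝ᵥ (S.coeff Pr u μ (t + 1)).P ω *ᵥ S.e Pr u (t + 1) ω := by
    rw [Matrix.dotProduct_mulVec, ← Matrix.mulVec_transpose, hP, dotProduct_comm]
  simp only [quadValue, ξArg, dArg, hx, Matrix.mulVec_add, dotProduct_add, add_dotProduct, hsymm]
  rw [dotProduct_comm _ (S.xPred Pr u (t + 1) ω), dotProduct_comm _ (S.e Pr u (t + 1) ω)]
  ring

theorem stepH_mul_K {ω : Ω} (hH : IsUnit (S.stepH Pr u μ t (S.coeff Pr u μ (t + 1)) ω)) :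
    S.stepH Pr u μ t (S.coeff Pr u μ (t + 1)) ω * S.K Pr u μ t ω =
      -(S.Bᵀ * S.stepV Pr u μ t (S.coeff Pr u μ (t + 1)) ω * S.A) := by
  rw [K, stepK, Matrix.mul_neg, Matrix.mul_assoc, Matrix.mul_assoc,
    Matrix.mul_nonsing_inv_cancel_left _ _ ((Matrix.isUnit_iff_isUnit_det _).1 hH),
    Matrix.mul_assoc]

theorem stepH_mulVec_l {ω : Ω} (hH : IsUnit (S.stepH Pr u μ t (S.coeff Pr u μ (t + 1)) ω)) :
    S.stepH Pr u μ t (S.coeff Pr u μ (t + 1)) ω *ᵥ S.l Pr u μ t ω =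
      -(S.Bᵀ *ᵥ (S.stepξ Pr u μ t (S.coeff Pr u μ (t + 1)) ω +
        S.stepV Pr u μ t (S.coeff Pr u μ (t + 1)) ω *ᵥ S.wbar Pr)) := by
  rw [l, stepl, Matrix.mulVec_neg, Matrix.mulVec_mulVec,
    Matrix.mul_nonsing_inv_cancel_left _ _ ((Matrix.isUnit_iff_isUnit_det _).1 hH)]

theorem xPred_measurable : CoordsIn (measAlg (S.F u t)) (S.xPred Pr u (t + 1)) :=
  condVec_coordsIn_measAlg _

theorem Admissible.u_measurable (hu : S.Admissible Pr u) (ht : t < S.N) :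
    CoordsIn (measAlg (S.F u t)) (u t) := fun i => by
  rw [hu.F_eq ht]
  exact (measurable_pi_apply i).comp (hu.measurable_info_zero ht)

theorem Admissible.g_measurable (hu : S.Admissible Pr u) (ht : t < S.N) :
    S.g Pr u μ t ∈ measAlg (S.F u t) :=
  (measAlg _).add_mem ((measAlg _).add_mem (quadForm_mem_alg xPred_measurable (Qμ_measurable μ t))
    ((measAlg _).mul_mem (const_mem_alg (2 * μ))
      (dotProduct_mem_alg xPred_measurable (m₃_measurable t))))
    (quadForm_mem_alg (hu.u_measurable ht) (EntriesIn.const _))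

theorem Admissible.loss_measurable (hu : S.Admissible Pr u) (ht : t < S.N) :
    S.loss Pr u μ t ∈ measAlg (S.F u t) :=
  quadForm_mem_alg ((hu.u_measurable ht).sub
    ((K_measurable.mulVec (condVec_coordsIn_measAlg _)).add l_measurable))
    ((((EntriesIn.const _).mul stepV_measurable).mul (EntriesIn.const _)).add (EntriesIn.const _))

theorem quadValue_measurable (ht : t < S.N) : S.quadValue Pr u μ t ∈ measAlg (S.F u t) := by
  obtain ⟨hP, hζ, hc⟩ := coeff_measurable (Pr := Pr) (u := u) (μ := μ) ht
  have hx : CoordsIn (measAlg (S.F u t)) (S.xEst Pr u t) := condVec_coordsIn_measAlg _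
  exact (measAlg _).add_mem ((measAlg _).add_mem (quadForm_mem_alg hx hP)
    ((measAlg _).mul_mem (const_mem_alg 2) (dotProduct_mem_alg hζ hx))) hc

theorem Admissible.F_mono (hu : S.Admissible Pr u) (ht : t + 1 < S.N) :
    S.F u t ≤ S.F u (t + 1) := by
  rw [hu.F_eq ht, hu.F_eq (by omega)]
  exact info_mono (Nat.le_succ t)

variable [IsProbabilityMeasure Pr]

theorem Admissible.integrable_g (hS : S.Standing Pr) (hu : S.Admissible Pr u) (ht : t < S.N) :
    Integrable (S.g Pr u μ t) Pr :=
  ((integrable_quadForm (hu.memLp_xPred hS ht) (hu.Qμ_mem hS μ ht)).add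
    ((integrable_dotProduct (hu.memLp_xPred hS ht) (hu.m₃_mem hS ht)).const_mul _)).add
    (integrable_quadForm (hu.memLp ht) (EntriesIn.const S.R))

theorem Admissible.integrable_quadValue (hS : S.Standing Pr) (hu : S.Admissible Pr u)
    (hμ : 0 ≤ μ) (t : ℕ) : Integrable (S.quadValue Pr u μ t) Pr := by
  obtain ht | ht := le_or_gt S.N t
  · rw [quadValue_of_le ht]
    exact integrable_zero _ _ _
  · obtain ⟨hP, hζ, hc, -⟩ := hu.coeff_mem hS hμ t
    have h2 : Integrable (fun ω => (S.coeff Pr u μ t).ζ ω ⬝ᵥ S.xEst Pr u t ω) Pr := by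
      simpa only [dotProduct_comm] using integrable_dotProduct (hu.memLp_xEst hS ht) hζ
    exact ((integrable_quadForm (hu.memLp_xEst hS ht) hP).add (h2.const_mul 2)).add
      (integrable_of_mem_momAlg hc)

/-- The dynamic programming identity: stage cost plus expected value at the next stage equals the
present value plus the loss of the stage. -/
theorem Admissible.g_add_condExp_quadValue (hS : S.Standing Pr) (hu : S.Admissible Pr u)
    (hμ : 0 ≤ μ) (ht : t < S.N) :
    (fun ω => S.g Pr u μ t ω + condExp (S.F u t) Pr (S.quadValue Pr u μ (t + 1)) ω) =ᵐ[Pr]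
      fun ω => S.quadValue Pr u μ t ω + S.loss Pr u μ t ω := by
  obtain ⟨hP, -, -, hpos⟩ := hu.coeff_mem hS hμ (t + 1)
  obtain ⟨-, hξ, hd⟩ := hu.coeff_args_mem hS hμ ht
  set q := S.coeff Pr u μ (t + 1) with hq
  have hs4 := hu.memLp_xPred hS ht
  have i1 : Integrable (fun ω => S.xPred Pr u (t + 1) ω ⬝ᵥ q.P ω *ᵥ S.xPred Pr u (t + 1) ω) Pr :=
    integrable_quadForm hs4 hP
  have i2 : Integrable (fun ω => S.xPred Pr u (t + 1) ω ⬝ᵥ S.ξArg Pr u t q ω) Pr :=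
    integrable_dotProduct hs4 hξ
  have hexp : S.quadValue Pr u μ (t + 1) =ᵐ[Pr] fun ω =>
      S.xPred Pr u (t + 1) ω ⬝ᵥ q.P ω *ᵥ S.xPred Pr u (t + 1) ω +
      2 * (S.xPred Pr u (t + 1) ω ⬝ᵥ S.ξArg Pr u t q ω) + S.dArg Pr u t q ω := by
    filter_upwards [hpos] with ω hω
    exact quadValue_succ_eq (by simpa using hω.isHermitian.eq)
  have e1 := condExp_quadForm (m := S.F u t) (Pr := Pr) xPred_measurable
    (fun i j => integrable_mul_of_memLp_four (hP i j) (hs4 i) (hs4 j))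
    fun i j => integrable_of_mem_momAlg (hP i j)
  have e2 := condExp_dotProduct (m := S.F u t) (Pr := Pr) xPred_measurable
    (fun i => integrable_mul_momAlg (hξ i) (hs4 i)) fun i => integrable_of_mem_momAlg (hξ i)
  have e3 := condExp_add (m := S.F u t) (i1.add (i2.const_mul 2)) (integrable_of_mem_momAlg hd)
  have e4 := condExp_add (m := S.F u t) i1 (i2.const_mul 2)
  have e5 := condExp_smul (μ := Pr) (2 : ℝ)
    (fun ω => S.xPred Pr u (t + 1) ω ⬝ᵥ S.ξArg Pr u t q ω) (S.F u t)
  filter_upwards [condExp_congr_ae (m := S.F u t) hexp, e1, e2, e3, e4, e5,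
    hu.V_posSemidef hS hμ ht, hu.xPred_succ_eq hS ht] with ω a0 a1 a2 a3 a4 a5 hV hx
  have hH := hS.stepH_posDef hV
  have key := completion_of_squares (A := S.A) (B := S.B) (R := S.R)
    (by simpa using hV.isHermitian.eq)
    (by simpa using hS.hR.isHermitian.eq) rfl (stepH_mul_K hH.isUnit) (stepH_mulVec_l hH.isUnit)
    (S.xEst Pr u t ω) (u t ω) (S.stepd Pr u t q ω)
  have hval : condExp (S.F u t) Pr (S.quadValue Pr u μ (t + 1)) ω =
      S.xPred Pr u (t + 1) ω ⬝ᵥ condMat Pr (S.F u t) q.P ω *ᵥ S.xPred Pr u (t + 1) ω +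
      2 * (S.xPred Pr u (t + 1) ω ⬝ᵥ condVec Pr (S.F u t) (S.ξArg Pr u t q) ω) +
        S.stepd Pr u t q ω := by
    rw [a0, ← a1, ← a2]
    refine a3.trans ?_
    refine congrArg₂ (· + ·) (a4.trans (congrArg₂ (· + ·) rfl a5)) rfl
  refine Eq.trans ?_ (key.trans ?_)
  · rw [hval, ← hx, g]
    simp only [stepV, stepξ, ← hq, Matrix.add_mulVec, dotProduct_add, dotProduct_smul, smul_eq_mul]
    ring
  · rw [quadValue, loss, coeff_of_lt ht]
    rfl

theorem Admissible.integrable_loss (hS : S.Standing Pr) (hu : S.Admissible Pr u)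
    (hμ : 0 ≤ μ) (ht : t < S.N) : Integrable (S.loss Pr u μ t) Pr := by
  refine (((hu.integrable_g (μ := μ) hS ht).add (integrable_condExp (m := S.F u t)
    (f := S.quadValue Pr u μ (t + 1)))).sub (hu.integrable_quadValue hS hμ t)).congr ?_
  filter_upwards [hu.g_add_condExp_quadValue hS hμ ht] with ω hω
  simp only [Pi.sub_apply, Pi.add_apply, hω]
  ring

theorem Admissible.loss_nonneg (hS : S.Standing Pr) (hu : S.Admissible Pr u)
    (hμ : 0 ≤ μ) (ht : t < S.N) : ∀ᵐ ω ∂Pr, 0 ≤ S.loss Pr u μ t ω := by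
  filter_upwards [hu.V_posSemidef hS hμ ht] with ω hV
  exact posSemidef_quadForm_nonneg (hS.stepH_posDef hV).posSemidef _

theorem Admissible.condExp_sum_sub_loss {t : ℕ} (hS : S.Standing Pr) (hu : S.Admissible Pr u)
    (hμ : 0 ≤ μ) (ht : t < S.N) :
    condExp (S.F u t) Pr (fun ω => ∑ s ∈ Finset.Ico t S.N, (S.g Pr u μ s ω - S.loss Pr u μ s ω))
      =ᵐ[Pr] S.quadValue Pr u μ t := by
  have hint : ∀ s ∈ Finset.Ico (t + 1) S.N,
      Integrable (fun ω => S.g Pr u μ s ω - S.loss Pr u μ s ω) Pr := fun s hs =>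
    (hu.integrable_g hS (Finset.mem_Ico.1 hs).2).sub
      (hu.integrable_loss hS hμ (Finset.mem_Ico.1 hs).2)
  have hfirst : Integrable (fun ω => S.g Pr u μ t ω - S.loss Pr u μ t ω) Pr :=
    (hu.integrable_g hS ht).sub (hu.integrable_loss hS hμ ht)
  have hnext : condExp (S.F u t) Pr
      (fun ω => ∑ s ∈ Finset.Ico (t + 1) S.N, (S.g Pr u μ s ω - S.loss Pr u μ s ω)) =ᵐ[Pr]
      condExp (S.F u t) Pr (S.quadValue Pr u μ (t + 1)) := by
    obtain h | h := (show t + 1 ≤ S.N from ht).lt_or_eq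
    · refine (condExp_condExp_of_le (hu.F_mono h) (hu.F_le hS h)).symm.trans ?_
      exact condExp_congr_ae (Admissible.condExp_sum_sub_loss hS hu hμ h)
    · rw [quadValue_of_le h.ge, h]
      simp only [Finset.Ico_self, Finset.sum_empty]
      rfl
  have hmeas : Measurable[S.F u t] fun ω => S.g Pr u μ t ω - S.loss Pr u μ t ω :=
    (measAlg _).sub_mem (hu.g_measurable ht) (hu.loss_measurable ht)
  simp only [Finset.sum_eq_sum_Ico_succ_bot ht]
  have hadd := condExp_add (m := S.F u t) hfirst (integrable_finsetSum _ hint)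
  rw [condExp_of_stronglyMeasurable (hu.F_le hS ht) hmeas.stronglyMeasurable hfirst] at hadd
  refine Filter.EventuallyEq.trans ?_ (hadd.trans ?_)
  · refine condExp_congr_ae (Filter.Eventually.of_forall fun ω => ?_)
    simp
  filter_upwards [hnext, hu.g_add_condExp_quadValue hS hμ ht] with ω h1 h2
  simp only [Pi.add_apply] at h1 ⊢
  rw [h1]
  linarith
termination_by S.N - t

/-- The conditional cost of an admissible input is the value at stage `t` plus the expected
losses from stage `t` on. -/
theorem Admissible.costFrom_eq (hS : S.Standing Pr) (hu : S.Admissible Pr u)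
    (hμ : 0 ≤ μ) (ht : t < S.N) :
    S.costFrom Pr u μ t =ᵐ[Pr] fun ω => S.quadValue Pr u μ t ω +
      condExp (S.F u t) Pr (fun ω => ∑ s ∈ Finset.Ico t S.N, S.loss Pr u μ s ω) ω := by
  have hg : Integrable (fun ω => ∑ s ∈ Finset.Ico t S.N,
      (S.g Pr u μ s ω - S.loss Pr u μ s ω)) Pr := integrable_finsetSum _ fun s hs =>
    (hu.integrable_g hS (Finset.mem_Ico.1 hs).2).sub
      (hu.integrable_loss hS hμ (Finset.mem_Ico.1 hs).2)
  have hl : Integrable (fun ω => ∑ s ∈ Finset.Ico t S.N, S.loss Pr u μ s ω) Pr :=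
    integrable_finsetSum _ fun s hs => hu.integrable_loss hS hμ (Finset.mem_Ico.1 hs).2
  have hadd := condExp_add (m := S.F u t) hg hl
  have hsum : (fun ω => ∑ s ∈ Finset.Ico t S.N, S.g Pr u μ s ω) =
      (fun ω => ∑ s ∈ Finset.Ico t S.N, (S.g Pr u μ s ω - S.loss Pr u μ s ω)) +
        fun ω => ∑ s ∈ Finset.Ico t S.N, S.loss Pr u μ s ω := by
    funext ω
    simp only [Pi.add_apply, ← Finset.sum_add_distrib, sub_add_cancel]
  rw [costFrom, hsum]
  filter_upwards [hadd, hu.condExp_sum_sub_loss hS hμ ht] with ω h1 h2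
  rw [h1, Pi.add_apply, h2]

end Value

/-! ### Feedback continuations -/

section ClosedLoop

variable {Ω : Type*} [m0 : MeasurableSpace Ω] {n p m : ℕ}

/-- The feedback law on the event `Γ`, and the input zero off `Γ`, as a function of the state `Z`.
The coefficients and the information are those of the input zero, which are common to all
admissible inputs. -/
def gatedLaw (S : LQSystem Ω n p m) (Pr : Measure Ω) (μ : ℝ) (Γ : Set Ω) (t : ℕ)
    (Z : Ω → (Fin n → ℝ)) : Ω → (Fin p → ℝ) :=
  Γ.indicator fun ω =>
    S.K Pr 0 μ t ω *ᵥ condVec Pr (S.info 0 t) (Γ.indicator Z) ω + S.l Pr 0 μ t ω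

/-- The state process under the input `u` before stage `k` and the gated feedback law from
stage `k` on. -/
def gatedState (S : LQSystem Ω n p m) (Pr : Measure Ω) (μ : ℝ) (Γ : Set Ω) (k : ℕ)
    (u : ℕ → Ω → (Fin p → ℝ)) : ℕ → Ω → (Fin n → ℝ)
  | 0 => fun _ => S.x₀
  | t + 1 => fun ω => S.A *ᵥ gatedState S Pr μ Γ k u t ω +
      S.B *ᵥ (if t < k then u t else S.gatedLaw Pr μ Γ t (gatedState S Pr μ Γ k u t)) ω +
      S.w (t + 1) ω

/-- The input `u` before stage `k` and the gated feedback law from stage `k` on. -/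
def gatedInput (S : LQSystem Ω n p m) (Pr : Measure Ω) (μ : ℝ) (Γ : Set Ω) (k : ℕ)
    (u : ℕ → Ω → (Fin p → ℝ)) (t : ℕ) : Ω → (Fin p → ℝ) :=
  if t < k then u t else S.gatedLaw Pr μ Γ t (S.gatedState Pr μ Γ k u t)

variable {S : LQSystem Ω n p m} {Pr : Measure Ω} {u : ℕ → Ω → (Fin p → ℝ)} {μ : ℝ} {t k : ℕ}
  {Γ : Set Ω}

theorem x_gatedInput (t : ℕ) :
    S.x (S.gatedInput Pr μ Γ k u) t = S.gatedState Pr μ Γ k u t := by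
  induction t with
  | zero => rfl
  | succ t ih => simp only [x, gatedState, ih]; rfl

theorem gatedInput_of_lt (ht : t < k) : S.gatedInput Pr μ Γ k u t = u t := if_pos ht

theorem gatedInput_of_le (ht : k ≤ t) :
    S.gatedInput Pr μ Γ k u t =
      S.gatedLaw Pr μ Γ t (S.x (S.gatedInput Pr μ Γ k u) t) := by
  rw [x_gatedInput]
  exact if_neg (by omega)

theorem gatedLaw_measurable (hΓ : MeasurableSet[S.info 0 k] Γ) (hk : k ≤ t) (ht : t < S.N)
    (Z : Ω → (Fin n → ℝ)) : Measurable[S.info 0 t] (S.gatedLaw Pr μ Γ t Z) := by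
  have hF := (admissible_zero (S := S) (Pr := Pr)).F_eq ht
  have hK : EntriesIn (measAlg (S.info 0 t)) (S.K Pr 0 μ t) := hF ▸ K_measurable
  have hl : CoordsIn (measAlg (S.info 0 t)) (S.l Pr 0 μ t) := hF ▸ l_measurable
  refine Measurable.indicator ?_ (info_mono hk _ hΓ)
  exact @measurable_pi_lambda _ _ _ (_) _ _
    ((hK.mulVec (condVec_coordsIn_measAlg _)).add hl)

variable [IsProbabilityMeasure Pr]

theorem gatedLaw_mem (hS : S.Standing Pr) (hμ : 0 ≤ μ) (hΓ : MeasurableSet[S.info 0 k] Γ)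
    (ht : t < S.N) {Z : Ω → (Fin n → ℝ)} (hZ : CoordsIn (momAlg Pr) (Γ.indicator Z)) :
    CoordsIn (momAlg Pr) (S.gatedLaw Pr μ Γ t Z) := by
  obtain ⟨hK, hl⟩ := (admissible_zero (S := S) (Pr := Pr)).gains_mem hS hμ ht
  exact indicator_mem_momAlg (hS.info_zero_le k _ hΓ)
    ((hK.mulVec (condVec_coordsIn_momAlg hZ)).add hl)

theorem gatedState_mem (hS : S.Standing Pr) (hμ : 0 ≤ μ) (hΓ : MeasurableSet[S.info 0 k] Γ)
    (hx : CoordsIn (momAlg Pr) (Γ.indicator (S.x u k))) (hk : k ≤ t) (ht : t ≤ S.N) :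
    CoordsIn (momAlg Pr) (Γ.indicator (S.x (S.gatedInput Pr μ Γ k u) t)) := by
  induction t, hk using Nat.le_induction with
  | base => rwa [S.x_congr fun s hs => gatedInput_of_lt hs]
  | succ t hk ih =>
    have hlaw := gatedLaw_mem hS hμ hΓ ht (ih (by omega))
    have hsum := (((EntriesIn.const S.A).mulVec (ih (by omega))).add
      ((EntriesIn.const S.B).mulVec hlaw)).add
        (indicator_mem_momAlg (hS.info_zero_le k _ hΓ) (hS.w_mem (t + 1)))
    convert hsum using 1
    funext ω
    by_cases hω : ω ∈ Γ
    · simp only [Set.indicator_of_mem hω, x, gatedInput_of_le hk]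
    · simp [hω, gatedLaw]

/-- The gated feedback law is an admissible continuation as soon as the state at stage `k` has
moments of every order on the event `Γ`. -/
theorem Admissible.gatedInput (hS : S.Standing Pr) (hu : S.Admissible Pr u) (hμ : 0 ≤ μ)
    (hΓ : MeasurableSet[S.info 0 k] Γ) (hx : CoordsIn (momAlg Pr) (Γ.indicator (S.x u k))) :
    S.Admissible Pr (S.gatedInput Pr μ Γ k u) := by
  refine admissible_of_measurable_info_zero (fun t ht => ?_) fun t ht i => ?_
  · obtain h | h := lt_or_ge t k
    · rw [gatedInput_of_lt h]
      exact hu.measurable_info_zero ht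
    · rw [gatedInput_of_le h]
      exact gatedLaw_measurable hΓ h ht _
  · obtain h | h := lt_or_ge t k
    · rw [gatedInput_of_lt h]
      exact hu.memLp ht i
    · rw [gatedInput_of_le h]
      exact memLp_four_of_mem_momAlg
        (gatedLaw_mem hS hμ hΓ ht (gatedState_mem hS hμ hΓ hx h ht.le) i)

/-- On the event `Γ` the gated input satisfies the feedback law from stage `k` on. -/
theorem gatedInput_eq (hS : S.Standing Pr)
    (hu' : S.Admissible Pr (S.gatedInput Pr μ Γ k u))
    (hΓ : MeasurableSet[S.info 0 k] Γ) (hk : k ≤ t) (ht : t < S.N) :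
    ∀ᵐ ω ∂Pr, ω ∈ Γ → S.gatedInput Pr μ Γ k u t ω =
      S.K Pr (S.gatedInput Pr μ Γ k u) μ t ω *ᵥ S.xEst Pr (S.gatedInput Pr μ Γ k u) t ω +
        S.l Pr (S.gatedInput Pr μ Γ k u) μ t ω := by
  have h := condVec_indicator (m := S.info 0 t) (Pr := Pr) (info_mono hk _ hΓ)
    (Z := S.x (S.gatedInput Pr μ Γ k u) t)
    fun i => integrable_of_memLp_four (hu'.memLp_x hS ht.le i)
  filter_upwards [h, hu'.gains_eq hS μ ht] with ω h1 ⟨h2, h3⟩ hω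
  rw [h2, h3, xEst, hu'.F_eq ht, ← h1 hω]
  conv_lhs => rw [gatedInput_of_le hk, gatedLaw, Set.indicator_of_mem hω]

end ClosedLoop

/-! ### The optimal cost-to-go -/

section CostToGo

variable {Ω : Type*} [m0 : MeasurableSpace Ω] {n p m : ℕ} {S : LQSystem Ω n p m} {Pr : Measure Ω}
  {u u' : ℕ → Ω → (Fin p → ℝ)} {μ : ℝ} {t : ℕ}

theorem loss_eq_zero {ω : Ω}
    (h : u t ω = S.K Pr u μ t ω *ᵥ S.xEst Pr u t ω + S.l Pr u μ t ω) :
    S.loss Pr u μ t ω = 0 := by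
  rw [loss, ← h, sub_self, zero_dotProduct]

variable [IsProbabilityMeasure Pr]

theorem quadValue_congr (hS : S.Standing Pr) (hu : S.Admissible Pr u) (hu' : S.Admissible Pr u')
    (ht : t < S.N) (h : ∀ s < t, u' s = u s) :
    S.quadValue Pr u' μ t =ᵐ[Pr] S.quadValue Pr u μ t := by
  have hx : S.xEst Pr u' t = S.xEst Pr u t := by
    rw [xEst, xEst, hu.F_eq ht, hu'.F_eq ht, S.x_congr h]
  filter_upwards [hu.coeff_eq hS μ t, hu'.coeff_eq hS μ t] with ω ⟨h1, h2, h3⟩ ⟨h4, h5, h6⟩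
  simp only [quadValue, hx, h1, h2, h3, h4, h5, h6]

theorem Admissible.quadValue_le_costFrom (hS : S.Standing Pr) (hu : S.Admissible Pr u)
    (hμ : 0 ≤ μ) (ht : t < S.N) : S.quadValue Pr u μ t ≤ᵐ[Pr] S.costFrom Pr u μ t := by
  have hall : ∀ᵐ ω ∂Pr, ∀ s < S.N, 0 ≤ S.loss Pr u μ s ω :=
    ae_all_iff.2 fun s => ae_all_iff.2 fun hs => hu.loss_nonneg hS hμ hs
  have hnn : 0 ≤ᵐ[Pr] condExp (S.F u t) Pr
      (fun ω => ∑ s ∈ Finset.Ico t S.N, S.loss Pr u μ s ω) :=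
    condExp_nonneg (hall.mono fun ω hω =>
      Finset.sum_nonneg fun s hs => hω s (Finset.mem_Ico.1 hs).2)
  filter_upwards [hu.costFrom_eq hS hμ ht, hnn] with ω h1 h2
  rw [h1]
  exact le_add_of_nonneg_right h2

/-- If the feedback law holds from stage `t` on on an event that is known at stage `t`, then the
conditional cost equals the value on that event. -/
theorem Admissible.costFrom_eq_of_feedback (hS : S.Standing Pr) (hu : S.Admissible Pr u)
    (hμ : 0 ≤ μ) (ht : t < S.N) {Γ : Set Ω} (hΓ : MeasurableSet[S.F u t] Γ)
    (h : ∀ s, t ≤ s → s < S.N → ∀ᵐ ω ∂Pr, ω ∈ Γ →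
      u s ω = S.K Pr u μ s ω *ᵥ S.xEst Pr u s ω + S.l Pr u μ s ω) :
    ∀ᵐ ω ∂Pr, ω ∈ Γ → S.costFrom Pr u μ t ω = S.quadValue Pr u μ t ω := by
  have hint : Integrable (fun ω => ∑ s ∈ Finset.Ico t S.N, S.loss Pr u μ s ω) Pr :=
    integrable_finsetSum _ fun s hs => hu.integrable_loss hS hμ (Finset.mem_Ico.1 hs).2
  have hall : ∀ᵐ ω ∂Pr, ∀ s, t ≤ s → s < S.N → ω ∈ Γ →
      u s ω = S.K Pr u μ s ω *ᵥ S.xEst Pr u s ω + S.l Pr u μ s ω :=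
    ae_all_iff.2 fun s => ae_all_iff.2 fun h1 => ae_all_iff.2 fun h2 => h s h1 h2
  have hzero : Γ.indicator (fun ω => ∑ s ∈ Finset.Ico t S.N, S.loss Pr u μ s ω) =ᵐ[Pr] 0 := by
    filter_upwards [hall] with ω hω
    by_cases hmem : ω ∈ Γ
    · rw [Set.indicator_of_mem hmem]
      exact Finset.sum_eq_zero fun s hs => loss_eq_zero
        (hω s (Finset.mem_Ico.1 hs).1 (Finset.mem_Ico.1 hs).2 hmem)
    · rw [Set.indicator_of_notMem hmem]
      rfl
  have h0 : condExp (S.F u t) Pr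
      (Γ.indicator fun ω => ∑ s ∈ Finset.Ico t S.N, S.loss Pr u μ s ω) =ᵐ[Pr] 0 := by
    have := condExp_congr_ae (m := S.F u t) hzero
    rwa [condExp_zero] at this
  filter_upwards [hu.costFrom_eq hS hμ ht, h0, condExp_indicator hint hΓ] with ω h1 h2 h3 hmem
  rw [h2, Set.indicator_of_mem hmem] at h3
  rw [h1, ← h3]
  simp

/-- On the event that the estimate is at most `M` the state has moments of every order, because
the estimation error has. -/
theorem Admissible.indicator_x_mem (hS : S.Standing Pr) (hu : S.Admissible Pr u) (ht : t < S.N)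
    (M : ℝ) (hΓ : MeasurableSet {ω | ∀ i, |S.xEst Pr u t ω i| ≤ M}) :
    CoordsIn (momAlg Pr) ({ω | ∀ i, |S.xEst Pr u t ω i| ≤ M}.indicator (S.x u t)) := by
  set Γ := {ω | ∀ i, |S.xEst Pr u t ω i| ≤ M} with hΓdef
  have h1 : CoordsIn (momAlg Pr) (Γ.indicator fun ω => S.x u t ω - S.xEst Pr u t ω) :=
    indicator_mem_momAlg hΓ fun i => momAlg_congr (hS.x_sub_xEst_zero_mem t i)
      ((hu.x_sub_xEst_eq hS ht).symm.mono fun ω hω => congrFun hω i)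
  have h2 : CoordsIn (momAlg Pr) (Γ.indicator (S.xEst Pr u t)) := fun i q => by
    have hmeas : Measurable fun ω => Γ.indicator (S.xEst Pr u t) ω i := by
      have : Measurable (S.xEst Pr u t) := measurable_pi_lambda _ fun i =>
        Measurable.mono (condVec_coordsIn_measAlg (Pr := Pr) (m := S.F u t) (S.x u t) i)
          (hu.F_le hS ht) le_rfl
      exact (measurable_pi_apply i).comp (this.indicator hΓ)
    refine MemLp.of_bound hmeas.aestronglyMeasurable |M| (Filter.Eventually.of_forall fun ω => ?_)
    by_cases hω : ω ∈ Γ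
    · rw [Set.indicator_of_mem hω]
      exact (hω i).trans (le_abs_self M)
    · simp [Set.indicator_of_notMem hω]
  convert h1.add h2 using 1
  funext ω
  by_cases hω : ω ∈ Γ <;> simp [hω]

/-- The quadratic value is the optimal cost-to-go.  The feedback law itself need not be an
admissible continuation, since its fourth moments may be infinite when the past inputs are merely
in `L⁴`; it is used on the events `|x̂_{t|t}| ≤ M`, which exhaust the sample space. -/
theorem Admissible.isOptimalCostToGo (hS : S.Standing Pr) (hu : S.Admissible Pr u)
    (hμ : 0 ≤ μ) (ht : t < S.N) : S.IsOptimalCostToGo Pr u μ t (S.quadValue Pr u μ t) := by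
  refine ⟨Measurable.mono (quadValue_measurable ht) (hu.F_le hS ht) le_rfl, ?_, ?_⟩
  · rintro f ⟨u', ⟨hu', hagree⟩, rfl⟩
    exact (quadValue_congr hS hu hu' ht hagree).symm.le.trans
      (hu'.quadValue_le_costFrom hS hμ ht)
  · intro g _ hg
    have hM : ∀ M : ℕ, ∀ᵐ ω ∂Pr, (∀ i, |S.xEst Pr u t ω i| ≤ M) →
        g ω ≤ S.quadValue Pr u μ t ω := fun M => by
      set Γ := {ω | ∀ i, |S.xEst Pr u t ω i| ≤ (M : ℝ)} with hΓdef
      have hΓ : MeasurableSet[S.info 0 t] Γ := by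
        rw [← hu.F_eq ht, hΓdef, Set.ofPred_forall]
        refine MeasurableSet.iInter fun i => ?_
        have : Measurable[S.F u t] fun ω => S.xEst Pr u t ω i :=
          condVec_coordsIn_measAlg (Pr := Pr) (m := S.F u t) (S.x u t) i
        exact (measurable_abs.comp this) measurableSet_Iic
      have hx := hu.indicator_x_mem hS ht M (hS.info_zero_le t _ hΓ)
      have hu' := hu.gatedInput hS hμ hΓ hx
      have hagree : ∀ s < t, S.gatedInput Pr μ Γ t u s = u s := fun s hs => gatedInput_of_lt hs
      filter_upwards [hg _ ⟨_, ⟨hu', hagree⟩, rfl⟩, quadValue_congr (μ := μ) hS hu hu' ht hagree,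
        hu'.costFrom_eq_of_feedback hS hμ ht (by rwa [hu'.F_eq ht]) fun s h1 h2 =>
          gatedInput_eq hS hu' hΓ h1 h2] with ω h1 h2 h3 hω
      rw [← h2, ← h3 hω]
      exact h1
    filter_upwards [ae_all_iff.2 hM] with ω hω
    obtain ⟨M, hM⟩ := exists_nat_ge (∑ i, |S.xEst Pr u t ω i|)
    exact hω M fun i => (Finset.single_le_sum (f := fun i => |S.xEst Pr u t ω i|)
      (fun i _ => abs_nonneg _) (Finset.mem_univ i)).trans hM

/-- The closed loop under the feedback law is well defined and admissible: started from the
deterministic initial state, it has moments of every order. -/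
theorem Standing.exists_feedback (hS : S.Standing Pr) (hμ : 0 ≤ μ) :
    ∃ u, S.Admissible Pr u ∧
      ∀ t < S.N, ∀ᵐ ω ∂Pr, u t ω = S.K Pr u μ t ω *ᵥ S.xEst Pr u t ω + S.l Pr u μ t ω := by
  have hΓ : MeasurableSet[S.info 0 0] (Set.univ : Set Ω) := MeasurableSet.univ
  have hx : CoordsIn (momAlg Pr) (Set.univ.indicator (S.x 0 0)) := by
    rw [Set.indicator_univ]
    exact CoordsIn.const _
  have hu' := (admissible_zero (S := S) (Pr := Pr)).gatedInput hS hμ hΓ hx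
  refine ⟨_, hu', fun t ht => ?_⟩
  filter_upwards [gatedInput_eq hS hu' hΓ (Nat.zero_le t) ht] with ω hω
  exact hω (Set.mem_univ ω)

end CostToGo

/-! ### The Lagrangian -/

section Lagrangian

variable {Ω : Type*} [m0 : MeasurableSpace Ω] {n p m : ℕ} {S : LQSystem Ω n p m} {Pr : Measure Ω}
  {u : ℕ → Ω → (Fin p → ℝ)} {μ : ℝ} {t : ℕ}

theorem Standing.lqCost_add_riskCost (hS : S.Standing Pr) (u : ℕ → Ω → (Fin p → ℝ)) (μ : ℝ)
    (ω : Ω) : S.lqCost u ω + μ * S.riskCost Pr u ω = S.x₀ ⬝ᵥ S.Q *ᵥ S.x₀ +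
      ∑ t ∈ Finset.range S.N, (S.g Pr u μ t ω +
        2 * (S.xPred Pr u (t + 1) ω ⬝ᵥ S.Q *ᵥ S.δ Pr u (t + 1) ω) +
        S.δ Pr u (t + 1) ω ⬝ᵥ S.Q *ᵥ S.δ Pr u (t + 1) ω) := by
  have hshift : S.lqCost u ω = S.x₀ ⬝ᵥ S.Q *ᵥ S.x₀ + ∑ t ∈ Finset.range S.N,
      (S.x u (t + 1) ω ⬝ᵥ S.Q *ᵥ S.x u (t + 1) ω + u t ω ⬝ᵥ S.R *ᵥ u t ω) := by
    have h1 := Finset.sum_range_succ (fun t => S.x u t ω ⬝ᵥ S.Q *ᵥ S.x u t ω) S.N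
    have h2 := Finset.sum_range_succ' (fun t => S.x u t ω ⬝ᵥ S.Q *ᵥ S.x u t ω) S.N
    have h3 : S.x u 0 ω = S.x₀ := rfl
    rw [h3] at h2
    rw [lqCost, Finset.sum_add_distrib, Finset.sum_add_distrib]
    linarith
  rw [hshift, riskCost, Finset.mul_sum, add_assoc, ← Finset.sum_add_distrib]
  refine congrArg _ (Finset.sum_congr rfl fun t _ => ?_)
  have hx : S.x u (t + 1) ω = S.xPred Pr u (t + 1) ω + S.δ Pr u (t + 1) ω := by
    simp only [δ]; abel
  have hsymm : S.δ Pr u (t + 1) ω ⬝ᵥ S.Q *ᵥ S.xPred Pr u (t + 1) ω =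
      S.xPred Pr u (t + 1) ω ⬝ᵥ S.Q *ᵥ S.δ Pr u (t + 1) ω := by
    rw [Matrix.dotProduct_mulVec, ← Matrix.mulVec_transpose, hS.hQt, dotProduct_comm]
  simp only [g, Qμ, hx, Matrix.add_mulVec, Matrix.smul_mulVec, Matrix.mulVec_add, dotProduct_add,
    add_dotProduct, dotProduct_smul, smul_eq_mul, hsymm]
  ring

variable [IsProbabilityMeasure Pr]

theorem Admissible.integrable_lqCost (hS : S.Standing Pr) (hu : S.Admissible Pr u) :
    Integrable (S.lqCost u) Pr := by
  refine (integrable_quadForm (hu.memLp_x hS le_rfl) (EntriesIn.const _)).add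
    (integrable_finsetSum _ fun t ht => ?_)
  have ht := Finset.mem_range.1 ht
  exact (integrable_quadForm (hu.memLp_x hS ht.le) (EntriesIn.const _)).add
    (integrable_quadForm (hu.memLp ht) (EntriesIn.const _))

theorem Admissible.integrable_riskCost (hS : S.Standing Pr) (hu : S.Admissible Pr u) :
    Integrable (S.riskCost Pr u) Pr := by
  refine integrable_finsetSum _ fun t ht => ?_
  have ht := Finset.mem_range.1 ht
  exact ((integrable_quadForm (hu.memLp_xPred hS ht)
    (((EntriesIn.const _).mul (hu.W_mem hS ht)).mul (EntriesIn.const _))).const_mul 4).add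
    ((integrable_dotProduct (hu.memLp_xPred hS ht) (hu.m₃_mem hS ht)).const_mul 2)

theorem Admissible.m₄Arg_mem (hS : S.Standing Pr) (hu : S.Admissible Pr u) (ht : t < S.N) :
    S.m₄Arg Pr u t ∈ momAlg Pr :=
  (momAlg Pr).pow_mem ((momAlg Pr).sub_mem (hu.δQδ_mem hS ht)
    (sum_mem_alg fun i _ => ((EntriesIn.const S.Q).mul (hu.W_mem hS ht)) i i)) 2

theorem Admissible.epsBar_eq (hS : S.Standing Pr) (hu : S.Admissible Pr u) (ε : ℝ) :
    S.epsBar Pr u ε = S.epsBar Pr 0 ε := by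
  have h0 := admissible_zero (S := S) (Pr := Pr)
  refine congrArg (ε - ·) (Finset.sum_congr rfl fun t ht => ?_)
  have ht := Finset.mem_range.1 ht
  rw [m₄, m₄, integral_condExp (hu.F_le hS ht), integral_condExp (h0.F_le hS ht)]
  refine integral_congr_ae ?_
  filter_upwards [hu.δ_eq hS ht, hu.W_eq hS ht] with ω h1 h2
  simp only [m₄Arg, h1, h2]

/-- The prediction error is orthogonal to the prediction. -/
theorem Admissible.integral_xPred_δ (hS : S.Standing Pr) (hu : S.Admissible Pr u) (ht : t < S.N) :
    Integrable (fun ω => S.xPred Pr u (t + 1) ω ⬝ᵥ S.Q *ᵥ S.δ Pr u (t + 1) ω) Pr ∧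
      ∫ ω, S.xPred Pr u (t + 1) ω ⬝ᵥ S.Q *ᵥ S.δ Pr u (t + 1) ω ∂Pr = 0 := by
  have hδ := hu.δ_mem hS ht
  have hQδ : CoordsIn (momAlg Pr) fun ω => S.Q *ᵥ S.δ Pr u (t + 1) ω :=
    (EntriesIn.const S.Q).mulVec hδ
  have hs4 := hu.memLp_xPred hS ht
  have hx : ∀ i, Integrable (fun ω => S.x u (t + 1) ω i) Pr := fun i =>
    integrable_of_memLp_four (hu.memLp_x hS ht i)
  refine ⟨integrable_dotProduct hs4 hQδ, ?_⟩
  have h0 : ∀ i, condExp (S.F u t) Pr (fun ω => S.δ Pr u (t + 1) ω i) =ᵐ[Pr] 0 := fun i => by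
    have h1 := condExp_sub (m := S.F u t) (hx i)
      (integrable_of_memLp_four (hs4 i))
    rw [condExp_of_stronglyMeasurable (hu.F_le hS ht) (f := fun ω => S.xPred Pr u (t + 1) ω i)
      (Measurable.stronglyMeasurable (xPred_measurable i))
      (integrable_of_memLp_four (hs4 i))] at h1
    refine h1.trans (Filter.Eventually.of_forall fun ω => ?_)
    exact sub_self _
  rw [← integral_condExp (hu.F_le hS ht), ← integral_zero Ω ℝ (μ := Pr)]
  refine integral_congr_ae ?_
  filter_upwards [condExp_dotProduct (m := S.F u t) (Pr := Pr) xPred_measurable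
    (fun i => integrable_mul_momAlg (hQδ i) (hs4 i)) fun i => integrable_of_mem_momAlg (hQδ i),
    condVec_mulVec (m := S.F u t) (Pr := Pr) S.Q fun i => integrable_of_mem_momAlg (hδ i),
    ae_all_iff.2 h0] with ω h1 h2 h3
  rw [h1, h2, show condVec Pr (S.F u t) (S.δ Pr u (t + 1)) ω = 0 from funext h3]
  simp

theorem Admissible.integral_sum_g (hS : S.Standing Pr) (hu : S.Admissible Pr u) (hμ : 0 ≤ μ) :
    ∑ t ∈ Finset.range S.N, ∫ ω, S.g Pr u μ t ω ∂Pr = ∫ ω, S.quadValue Pr 0 μ 0 ω ∂Pr +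
      ∑ t ∈ Finset.range S.N, ∫ ω, S.loss Pr u μ t ω ∂Pr := by
  obtain hN | hN := Nat.eq_zero_or_pos S.N
  · simp [hN, quadValue_of_le hN.le]
  have hg : ∀ t ∈ Finset.range S.N, Integrable (S.g Pr u μ t) Pr := fun t ht =>
    hu.integrable_g hS (Finset.mem_range.1 ht)
  have hl : ∀ t ∈ Finset.range S.N, Integrable (S.loss Pr u μ t) Pr := fun t ht =>
    hu.integrable_loss hS hμ (Finset.mem_range.1 ht)
  have hle := hu.F_le hS hN
  have h := integral_congr_ae (hu.costFrom_eq hS hμ hN)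
  rw [integral_add (hu.integrable_quadValue hS hμ 0) integrable_condExp, integral_condExp hle,
    costFrom, integral_condExp hle, ← Finset.range_eq_Ico, integral_finsetSum _ hg,
    integral_finsetSum _ hl, integral_congr_ae
      (quadValue_congr hS (admissible_zero (S := S) (Pr := Pr)) hu hN fun s hs => by omega)] at h
  exact h

/-- The Lagrangian of an admissible input is a constant plus the sum of its expected losses. -/
theorem Admissible.lagrangian_eq (hS : S.Standing Pr) (hu : S.Admissible Pr u) (hμ : 0 ≤ μ)
    (ε : ℝ) : S.Lagrangian Pr u ε μ = S.x₀ ⬝ᵥ S.Q *ᵥ S.x₀ +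
      (∫ ω, S.quadValue Pr 0 μ 0 ω ∂Pr + ∑ t ∈ Finset.range S.N,
        ∫ ω, S.δ Pr 0 (t + 1) ω ⬝ᵥ S.Q *ᵥ S.δ Pr 0 (t + 1) ω ∂Pr) - μ * S.epsBar Pr 0 ε +
      ∑ t ∈ Finset.range S.N, ∫ ω, S.loss Pr u μ t ω ∂Pr := by
  have hstage : ∀ t ∈ Finset.range S.N,
      Integrable (fun ω => S.g Pr u μ t ω +
        2 * (S.xPred Pr u (t + 1) ω ⬝ᵥ S.Q *ᵥ S.δ Pr u (t + 1) ω) +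
        S.δ Pr u (t + 1) ω ⬝ᵥ S.Q *ᵥ S.δ Pr u (t + 1) ω) Pr ∧
      ∫ ω, (S.g Pr u μ t ω +
        2 * (S.xPred Pr u (t + 1) ω ⬝ᵥ S.Q *ᵥ S.δ Pr u (t + 1) ω) +
        S.δ Pr u (t + 1) ω ⬝ᵥ S.Q *ᵥ S.δ Pr u (t + 1) ω) ∂Pr =
      ∫ ω, S.g Pr u μ t ω ∂Pr +
        ∫ ω, S.δ Pr 0 (t + 1) ω ⬝ᵥ S.Q *ᵥ S.δ Pr 0 (t + 1) ω ∂Pr := fun t ht => by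
    have ht := Finset.mem_range.1 ht
    obtain ⟨hi, h0⟩ := hu.integral_xPred_δ hS ht
    have hg := hu.integrable_g (μ := μ) hS ht
    have hδ := integrable_of_mem_momAlg (hu.δQδ_mem hS ht)
    have hgi : Integrable (fun ω => S.g Pr u μ t ω +
        2 * (S.xPred Pr u (t + 1) ω ⬝ᵥ S.Q *ᵥ S.δ Pr u (t + 1) ω)) Pr := hg.add (hi.const_mul 2)
    refine ⟨hgi.add hδ, ?_⟩
    rw [integral_add hgi hδ, integral_add hg (hi.const_mul 2),
      integral_const_mul, h0, mul_zero, add_zero]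
    refine congrArg _ (integral_congr_ae ?_)
    filter_upwards [hu.δ_eq hS ht] with ω hω
    rw [hω]
  have hsum : S.J Pr u + μ * S.JR Pr u = S.x₀ ⬝ᵥ S.Q *ᵥ S.x₀ +
      (∑ t ∈ Finset.range S.N, ∫ ω, S.g Pr u μ t ω ∂Pr + ∑ t ∈ Finset.range S.N,
        ∫ ω, S.δ Pr 0 (t + 1) ω ⬝ᵥ S.Q *ᵥ S.δ Pr 0 (t + 1) ω ∂Pr) := by
    rw [J, JR, ← integral_const_mul, ← integral_add (hu.integrable_lqCost hS)
      ((hu.integrable_riskCost hS).const_mul μ)]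
    simp only [hS.lqCost_add_riskCost u μ]
    rw [integral_add (integrable_const _) (integrable_finsetSum _ fun t ht => (hstage t ht).1),
      integral_finsetSum _ fun t ht => (hstage t ht).1, integral_const,
      Finset.sum_congr rfl fun t ht => (hstage t ht).2, Finset.sum_add_distrib]
    simp
  rw [Lagrangian, hsum, hu.integral_sum_g hS hμ, hu.epsBar_eq hS ε]
  ring

theorem Admissible.lagrangian_eq_dual (hS : S.Standing Pr) (hu : S.Admissible Pr u) (hμ : 0 ≤ μ)
    (ε : ℝ) (h : ∀ t < S.N, ∀ᵐ ω ∂Pr,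
      u t ω = S.K Pr u μ t ω *ᵥ S.xEst Pr u t ω + S.l Pr u μ t ω) :
    (S.Lagrangian Pr u ε μ : EReal) = S.dual Pr ε μ := by
  refine le_antisymm (le_iInf fun u' => ?_) (iInf_le (fun u' : {u // S.Admissible Pr u} =>
    (S.Lagrangian Pr u'.1 ε μ : EReal)) ⟨u, hu⟩)
  rw [EReal.coe_le_coe_iff, hu.lagrangian_eq hS hμ, u'.2.lagrangian_eq hS hμ]
  refine add_le_add le_rfl (Finset.sum_le_sum fun t ht => ?_)
  have ht := Finset.mem_range.1 ht
  rw [integral_congr_ae (g := 0) ((h t ht).mono fun ω hω => loss_eq_zero hω)]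
  simp only [Pi.zero_apply, integral_zero]
  exact integral_nonneg_of_ae (u'.2.loss_nonneg hS hμ ht)

theorem Admissible.costsWellDefined (hS : S.Standing Pr) (hu : S.Admissible Pr u) (μ : ℝ) :
    S.CostsWellDefined Pr u μ :=
  ⟨hu.integrable_lqCost hS, hu.integrable_riskCost hS, fun _ ht =>
    ⟨integrable_of_mem_momAlg (hu.m₄Arg_mem hS ht), hu.integrable_g hS ht⟩⟩

theorem Admissible.recursionWellDefined (hS : S.Standing Pr) (hu : S.Admissible Pr u)
    (hμ : 0 ≤ μ) : S.RecursionWellDefined Pr u μ := fun t ht => by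
  obtain ⟨hP, -, -, -⟩ := hu.coeff_mem hS hμ (t + 1)
  obtain ⟨-, hξ, hd⟩ := hu.coeff_args_mem hS hμ ht
  have hδ := hu.δ_mem hS ht
  exact ⟨fun i => integrable_of_memLp_four (hu.memLp_x hS ht.le i),
    fun i => integrable_of_memLp_four (hu.memLp_x hS ht i),
    fun i j => integrable_of_mem_momAlg (hδ.vecMulVec hδ i j),
    fun i => integrable_of_mem_momAlg (CoordsIn.smul (hu.δQδ_mem hS ht) hδ i),
    fun i j => integrable_of_mem_momAlg (hP i j), fun i => integrable_of_mem_momAlg (hξ i),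
    integrable_of_mem_momAlg hd,
    (hu.V_posSemidef hS hμ ht).mono fun ω hV => (hS.stepH_posDef hV).isUnit⟩

end Lagrangian

end LQSystem

end

theorem mainTheorem1 {Ω : Type*} [MeasurableSpace Ω] (Pr : Measure Ω) [IsProbabilityMeasure Pr]
    {n p m : ℕ} (S : LQSystem Ω n p m)
    (hQ : S.Q.PosSemidef) (hR : S.R.PosDef)
    (hw : ∀ t, Measurable (S.w t)) (hv : ∀ t, Measurable (S.v t))
    (hindep : iIndepFun (fun t ω => (S.w t ω, S.v t ω)) Pr)
    (hident : ∀ t, IdentDistrib (fun ω => (S.w t ω, S.v t ω)) (fun ω => (S.w 0 ω, S.v 0 ω)) Pr Pr)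
    (hmom : ∀ (t q : ℕ), MemLp (fun ω => WithLp.toLp 2 (S.w t ω)) (q : ENNReal) Pr)
    (ε μ : ℝ) (hμ : 0 ≤ μ) :
    (∀ u, S.Admissible Pr u →
      S.CostsWellDefined Pr u μ ∧ S.RecursionWellDefined Pr u μ ∧
      ∀ t < S.N,
        (∀ i j, Measurable[S.F u t] fun ω => (S.coeff Pr u μ t).P ω i j) ∧
        (∀ i, Measurable[S.F u t] fun ω => (S.coeff Pr u μ t).ζ ω i) ∧
        Measurable[S.F u t] (S.coeff Pr u μ t).c ∧
        S.IsOptimalCostToGo Pr u μ t (S.quadValue Pr u μ t)) ∧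
    (∃ u, S.Admissible Pr u ∧
      ∀ t < S.N, ∀ᵐ ω ∂Pr, u t ω = S.K Pr u μ t ω *ᵥ S.xEst Pr u t ω + S.l Pr u μ t ω) ∧
    (∀ u, S.Admissible Pr u →
      (∀ t < S.N, ∀ᵐ ω ∂Pr, u t ω = S.K Pr u μ t ω *ᵥ S.xEst Pr u t ω + S.l Pr u μ t ω) →
      (S.Lagrangian Pr u ε μ : EReal) = S.dual Pr ε μ) := by
  have hS : S.Standing Pr := ⟨hQ, hR, hw, hv, hindep, hident, hmom⟩
  exact ⟨fun u hu => ⟨hu.costsWellDefined hS μ, hu.recursionWellDefined hS hμ, fun t ht =>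
      have h := LQSystem.coeff_measurable (Pr := Pr) (u := u) (μ := μ) ht
      ⟨h.1, h.2.1, h.2.2, hu.isOptimalCostToGo hS hμ ht⟩⟩,
    hS.exists_feedback hμ, fun u hu h => hu.lagrangian_eq_dual hS hμ ε h⟩
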